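/- Let $K$ be a field of characteristic $0$ with a derivation $\partial$. A $\partial$-$K$-algebra is a commutative $K$-algebra $B$ with a derivation extending that of $K$; a $\partial$-$K$-homomorphism is a $K$-algebra homomorphism commuting with $\partial$. Let $G$ be a linear differential algebraic group over $K$, that is, the group functor $B\mapsto G(B)=\mathrm{Hom}_{\partial\text{-}K}(A,B)$ on $\partial$-$K$-algebras represented by a commutative Hopf algebra $A$ over $K$ which is a finitely $\partial$-generated $\partial$-$K$-algebra and whose comultiplication $\Delta$, counit $\varepsilon$ and antipode $S$ commute with the derivations ($A\otimes_K A$ carries $\partial\otimes 1+1\otimes\partial$); the group law is $(g\cdot h)(a)=(g\otimes h)(\Delta a)$. Let $\mathrm{Rep}_G$ be the category of finite-dimensional $K$-vector spaces $X$ with a right $A$-comodule structure $\rho_X:X\to X\otimes_K A$ and linear maps commuting with the coactions, with its usual tensor product and unit object $\mathbf 1=K$, and let $\omega$ be the forgetful functor to the category $\mathrm{Seq}$ of finite-dimensional $K$-vector spaces. For a vector space $V$ put $V^{(1)}=K[\partial]_{\le 1}\otimes_K V$ (where $\partial a=a\partial+\partial(a)$ in $K[\partial]$, and $\partial v:=\partial\otimes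 v$); for $X\in\mathrm{Rep}_G$ the space $X^{(1)}$ is a representation through $\rho(1\otimes v)=\rho_X(v)$ and $\rho(\partial v)=\sum_i(\partial v_i\otimes a_i+v_i\otimes\partial a_i)$ if $\rho_X(v)=\sum_i v_i\otimes a_i$. For a $\partial$-$K$-algebra $B$ let $\partial:X\otimes B\to X^{(1)}\otimes B$ be the additive map $v\otimes b\mapsto \partial v\otimes b+v\otimes\partial b$. Let $\mathrm{Aut}^{\otimes,\partial}(\omega)(B)$ be the group, under componentwise composition, of all families $(\lambda_X)_{X\in\mathrm{Ob}(\mathrm{Rep}_G)}$ of $B$-linear automorphisms $\lambda_X$ of $\omega(X)\otimes_K B$ such that (i) $\lambda_{X\otimes Y}=\lambda_X\otimes\lambda_Y$ for all $X,Y$; (ii) $\lambda_{\mathbf 1}=\mathrm{id}_B$; (iii) $\lambda_Y\circ(\alpha\otimes\mathrm{id}_B)=(\alpha\otimes\mathrm{id}_B)\circ\lambda_X$ for all $\alpha\in\mathrm{Hom}_G(X,Y)$; (iv) $\partial\circ\lambda_X=\lambda_{X^{(1)}}\circ\partial$ for all $X$. This is a functor from $\partial$-$K$-algebras to groups: $\varphi:B_1\to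 B_2$ sends $(\lambda_X)$ to the family of $B_2$-linear extensions of $v\mapsto(\mathrm{id}\otimes\varphi)(\lambda_X(v\otimes 1))$. Then $G\cong\mathrm{Aut}^{\otimes,\partial}(\omega)$ as functors from $\partial$-$K$-algebras to groups. More precisely, sending $g\in G(B)$ to the family $\lambda_X=$ the $B$-linear extension of $v\mapsto(\mathrm{id}_X\otimes g)(\rho_X(v))$ defines an isomorphism of group functors. -/

import Mathlib

open scoped TensorProduct Differential
open CategoryTheory

universe u

noncomputable section

set_option linter.unusedSectionVars false

namespace DiffTannaka

/-! ### Additive operators satisfying the Leibniz rule over `K` -/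

section Leibniz

variable {K : Type*} [Field K] [Differential K]

/-- An additive endomorphism `δ` of a `K`-vector space is *Leibniz* if
`δ (k m) = ∂(k) m + k δ(m)`. -/
def IsLeibniz (K : Type*) [Field K] [Differential K] {M : Type*} [AddCommGroup M] [Module K M]
    (δ : M →+ M) : Prop :=
  ∀ (k : K) (m : M), δ (k • m) = k′ • m + k • δ m

/-- The derivation of a differential ring, as an additive map. -/
def derivHom (B : Type*) [CommRing B] [Differential B] : B →+ B :=
  (Differential.deriv (R := B)).toLinearMap.toAddMonoidHom

@[simp] theorem derivHom_apply {B : Type*} [CommRing B] [Differential B] (b : B) :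
    derivHom B b = b′ := rfl

theorem isLeibniz_derivHom (K : Type*) [Field K] [Differential K] (B : Type*) [CommRing B]
    [Algebra K B] [Differential B] [DifferentialAlgebra K B] : IsLeibniz K (derivHom B) := by
  intro k b
  rw [derivHom_apply, derivHom_apply, Algebra.smul_def k b, Derivation.leibniz, deriv_algebraMap,
    smul_eq_mul, smul_eq_mul, Algebra.smul_def k′, Algebra.smul_def k]
  ring

/-- The operator `δ ⊗ 1 + 1 ⊗ δ'` on `M ⊗ N`. -/
def tensorLeibniz {M N : Type*} [AddCommGroup M] [Module K M] [AddCommGroup N] [Module K N]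
    (δ : M →+ M) (hδ : IsLeibniz K δ) (δ' : N →+ N) (hδ' : IsLeibniz K δ') :
    M ⊗[K] N →+ M ⊗[K] N :=
  TensorProduct.liftAddHom
    (AddMonoidHom.mk' (fun m => AddMonoidHom.mk' (fun n => δ m ⊗ₜ[K] n + m ⊗ₜ[K] δ' n)
        (fun n n' => by simp only [map_add, TensorProduct.tmul_add]; abel))
      (fun m m' => by
        ext n
        simp only [map_add, TensorProduct.add_tmul, AddMonoidHom.mk'_apply, AddMonoidHom.add_apply]
        abel))
    (fun k m n => by
      simp only [AddMonoidHom.mk'_apply, hδ k m, hδ' k n, TensorProduct.add_tmul,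
        TensorProduct.tmul_add, TensorProduct.smul_tmul, TensorProduct.tmul_smul]
      abel)

@[simp] theorem tensorLeibniz_tmul {M N : Type*} [AddCommGroup M] [Module K M] [AddCommGroup N]
    [Module K N] (δ : M →+ M) (hδ : IsLeibniz K δ) (δ' : N →+ N) (hδ' : IsLeibniz K δ')
    (m : M) (n : N) :
    tensorLeibniz δ hδ δ' hδ' (m ⊗ₜ[K] n) = δ m ⊗ₜ[K] n + m ⊗ₜ[K] δ' n := rfl

theorem isLeibniz_tensorLeibniz {M N : Type*} [AddCommGroup M] [Module K M] [AddCommGroup N]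
    [Module K N] (δ : M →+ M) (hδ : IsLeibniz K δ) (δ' : N →+ N) (hδ' : IsLeibniz K δ') :
    IsLeibniz K (tensorLeibniz δ hδ δ' hδ') := by
  intro k x
  induction x with
  | zero => simp
  | add x y hx hy => simp only [smul_add, map_add, hx, hy]; abel
  | tmul m n =>
    rw [TensorProduct.smul_tmul', tensorLeibniz_tmul, tensorLeibniz_tmul, hδ]
    simp only [TensorProduct.add_tmul, TensorProduct.smul_tmul', smul_add]
    abel

/-- The derivation `∂ ⊗ 1 + 1 ⊗ ∂` of the tensor product of two `∂`-`K`-algebras. -/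
def tensorDeriv (K : Type*) [Field K] [Differential K] (A B : Type*) [CommRing A] [Algebra K A]
    [Differential A] [DifferentialAlgebra K A] [CommRing B] [Algebra K B]
    [Differential B] [DifferentialAlgebra K B] : A ⊗[K] B →+ A ⊗[K] B :=
  tensorLeibniz (derivHom A) (isLeibniz_derivHom K A) (derivHom B) (isLeibniz_derivHom K B)

theorem isLeibniz_tensorDeriv (K : Type*) [Field K] [Differential K] (A B : Type*) [CommRing A]
    [Algebra K A] [Differential A] [DifferentialAlgebra K A] [CommRing B] [Algebra K B]
    [Differential B] [DifferentialAlgebra K B] : IsLeibniz K (tensorDeriv K A B) :=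
  isLeibniz_tensorLeibniz _ _ _ _

end Leibniz

/-! ### Differential Hopf algebras -/

/-- A *Hopf `∂`-`K`-algebra*: a commutative `∂`-`K`-algebra `A` with a Hopf algebra structure whose
comultiplication, counit and antipode commute with the derivations (the tensor product `A ⊗ A`
carries `∂ ⊗ 1 + 1 ⊗ ∂`). -/
class DiffHopfAlgebra (K A : Type*) [Field K] [Differential K] [CommRing A] [HopfAlgebra K A]
    [Differential A] : Prop extends DifferentialAlgebra K A where
  comul_deriv : ∀ a : A, Coalgebra.comul (R := K) a′ = tensorDeriv K A A (Coalgebra.comul a)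
  counit_deriv : ∀ a : A, Coalgebra.counit (R := K) a′ = ((Coalgebra.counit (R := K) a)′)
  antipode_deriv : ∀ a : A, HopfAlgebra.antipode K a′ = ((HopfAlgebra.antipode K a)′)

/-- `A` is finitely `∂`-generated over `K`: for some finite set `s`, the elements `∂ⁱ x`, `x ∈ s`,
`i ≥ 0`, generate `A` as a `K`-algebra. -/
def FinitelyDiffGenerated (K A : Type*) [Field K] [CommRing A] [Algebra K A] [Differential A] :
    Prop :=
  ∃ s : Finset A, Algebra.adjoin K {y : A | ∃ x ∈ s, ∃ i : ℕ, y = (fun z : A => z′)^[i] x} = ⊤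

/-! ### The category of `∂`-`K`-algebras -/

/-- `∂`-`K`-algebras. -/
structure DiffAlg (K : Type u) [Field K] [Differential K] : Type (u + 1) where
  carrier : Type u
  [commRing : CommRing carrier]
  [algebra : Algebra K carrier]
  [differential : Differential carrier]
  [differentialAlgebra : DifferentialAlgebra K carrier]

attribute [instance] DiffAlg.commRing DiffAlg.algebra DiffAlg.differential
  DiffAlg.differentialAlgebra

instance (K : Type u) [Field K] [Differential K] : CoeSort (DiffAlg K) (Type u) :=
  ⟨DiffAlg.carrier⟩

/-- `∂`-`K`-homomorphisms. -/
@[ext]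
structure DiffAlgHom (K A B : Type*) [Field K] [CommRing A] [Algebra K A] [Differential A]
    [CommRing B] [Algebra K B] [Differential B] where
  toAlgHom : A →ₐ[K] B
  map_deriv : ∀ a : A, toAlgHom a′ = (toAlgHom a)′

namespace DiffAlgHom

variable {K A B C : Type*} [Field K] [CommRing A] [Algebra K A] [Differential A]
  [CommRing B] [Algebra K B] [Differential B] [CommRing C] [Algebra K C] [Differential C]

/-- The identity. -/
def id (K A : Type*) [Field K] [CommRing A] [Algebra K A] [Differential A] : DiffAlgHom K A A :=
  ⟨AlgHom.id K A, fun _ => rfl⟩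

/-- Composition `g ∘ f`. -/
def comp (g : DiffAlgHom K B C) (f : DiffAlgHom K A B) : DiffAlgHom K A C :=
  ⟨g.toAlgHom.comp f.toAlgHom, fun a => by simp [f.map_deriv, g.map_deriv]⟩

end DiffAlgHom

instance (K : Type u) [Field K] [Differential K] : Category (DiffAlg K) where
  Hom A B := DiffAlgHom K A B
  id A := DiffAlgHom.id K A
  comp f g := DiffAlgHom.comp g f

/-! ### The group functor represented by a Hopf `∂`-`K`-algebra -/

section Points

variable {K A B C : Type*} [Field K] [Differential K] [CommRing A] [HopfAlgebra K A]
  [Differential A] [DiffHopfAlgebra K A] [CommRing B] [Algebra K B] [Differential B]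
  [DifferentialAlgebra K B] [CommRing C] [Algebra K C] [Differential C] [DifferentialAlgebra K C]

namespace DiffAlgHom

theorem mul_map_deriv (f g : DiffAlgHom K A B) (x : A ⊗[K] A) :
    Algebra.TensorProduct.lmul' K (Algebra.TensorProduct.map f.toAlgHom g.toAlgHom
      (tensorDeriv K A A x)) =
    (Algebra.TensorProduct.lmul' K (Algebra.TensorProduct.map f.toAlgHom g.toAlgHom x))′ := by
  induction x with
  | zero => simp
  | add x y hx hy => simp only [map_add, hx, hy]
  | tmul a b =>
    simp [tensorDeriv, f.map_deriv, g.map_deriv]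
    ring

/-- `(f · g)(a) = (f ⊗ g)(Δ a)` -/
instance : Mul (DiffAlgHom K A B) where
  mul f g :=
    ⟨(Algebra.TensorProduct.lmul' K).comp
      ((Algebra.TensorProduct.map f.toAlgHom g.toAlgHom).comp (Bialgebra.comulAlgHom K A)),
      fun a => by
        simpa [DiffHopfAlgebra.comul_deriv] using mul_map_deriv f g (Coalgebra.comul a)⟩

instance : One (DiffAlgHom K A B) where
  one := ⟨(Algebra.ofId K B).comp (Bialgebra.counitAlgHom K A), fun a => by
    simp [DiffHopfAlgebra.counit_deriv, Algebra.ofId_apply, deriv_algebraMap]⟩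

instance : Inv (DiffAlgHom K A B) where
  inv f := ⟨f.toAlgHom.comp (HopfAlgebra.antipodeAlgHom K A), fun a => by
    simp [DiffHopfAlgebra.antipode_deriv, f.map_deriv]⟩

theorem toConv_mul (f g : DiffAlgHom K A B) :
    WithConv.toConv (f * g).toAlgHom = WithConv.toConv f.toAlgHom * WithConv.toConv g.toAlgHom :=
  rfl

theorem toConv_one :
    WithConv.toConv (1 : DiffAlgHom K A B).toAlgHom = 1 :=
  rfl

theorem toConv_injective {f g : DiffAlgHom K A B}
    (h : WithConv.toConv f.toAlgHom = WithConv.toConv g.toAlgHom) : f = g :=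
  DiffAlgHom.ext (WithConv.toConv_injective h)

/-- The group `G(B) = Hom(A, B)`. -/
instance : Group (DiffAlgHom K A B) where
  mul_assoc f g h := toConv_injective (by simp only [toConv_mul, mul_assoc])
  one_mul f := toConv_injective (by rw [toConv_mul, toConv_one, one_mul])
  mul_one f := toConv_injective (by rw [toConv_mul, toConv_one, mul_one])
  inv_mul_cancel f := by
    apply DiffAlgHom.ext
    apply AlgHom.ext
    intro a
    have H : (Algebra.TensorProduct.lmul' K).comp
        (Algebra.TensorProduct.map (f.toAlgHom.comp (HopfAlgebra.antipodeAlgHom K A)) f.toAlgHom) =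
        f.toAlgHom.comp ((Algebra.TensorProduct.lmul' K).comp
          (Algebra.TensorProduct.map (HopfAlgebra.antipodeAlgHom K A) (AlgHom.id K A))) := by
      ext <;> simp
    have h1 := DFunLike.congr_fun H (Coalgebra.comul a)
    have h2 := HopfAlgebra.mul_antipode_rTensor_comul_apply (R := K) a
    have h3 : Algebra.TensorProduct.lmul' K (Algebra.TensorProduct.map
        (HopfAlgebra.antipodeAlgHom K A) (AlgHom.id K A) (Coalgebra.comul a)) =
        algebraMap K A (Coalgebra.counit a) := h2
    change Algebra.TensorProduct.lmul' K (Algebra.TensorProduct.map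
      (f.toAlgHom.comp (HopfAlgebra.antipodeAlgHom K A)) f.toAlgHom (Coalgebra.comul a)) =
      algebraMap K B (Coalgebra.counit a)
    refine h1.trans ?_
    change f.toAlgHom (Algebra.TensorProduct.lmul' K (Algebra.TensorProduct.map
        (HopfAlgebra.antipodeAlgHom K A) (AlgHom.id K A) (Coalgebra.comul a))) = _
    rw [h3, AlgHom.commutes]

/-- Composition with a `∂`-`K`-homomorphism `φ : B → C`, as a group homomorphism
`G(B) → G(C)`. -/
def pointsMap (φ : DiffAlgHom K B C) : DiffAlgHom K A B →* DiffAlgHom K A C where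
  toFun f := φ.comp f
  map_one' := DiffAlgHom.ext (AlgHom.ext fun _ => φ.toAlgHom.commutes _)
  map_mul' f g := toConv_injective (congrArg WithConv.toConv
    (AlgHom.comp_convMul_distrib φ.toAlgHom (WithConv.toConv f.toAlgHom)
      (WithConv.toConv g.toAlgHom)))

end DiffAlgHom

end Points

/-- The group functor `G : B ↦ Hom(A, B)` on `∂`-`K`-algebras. -/
def pointsFunctor (K A : Type u) [Field K] [Differential K] [CommRing A] [HopfAlgebra K A]
    [Differential A] [DiffHopfAlgebra K A] : DiffAlg K ⥤ GrpCat.{u} where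
  obj B := GrpCat.of (DiffAlgHom K A B)
  map φ := GrpCat.ofHom (DiffAlgHom.pointsMap φ)

/-! ### Prolongation of vector spaces -/

/-- The prolongation `V⁽¹⁾ = K[∂]_{≤1} ⊗ V`. As a right `K`-space `K[∂]_{≤1}` has the basis
`1, ∂`, so an element is uniquely `1 ⊗ v₀ + ∂ ⊗ v₁`; it is stored as the pair `(v₀, v₁)`. -/
@[ext]
structure Prolong (V : Type*) where
  coeff0 : V
  coeff1 : V

namespace Prolong

variable {K V W : Type*} [Field K] [Differential K] [AddCommGroup V] [Module K V]
  [AddCommGroup W] [Module K W]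

/-- The underlying pair. -/
def equivProd (V : Type*) : Prolong V ≃ V × V where
  toFun x := (x.coeff0, x.coeff1)
  invFun x := ⟨x.1, x.2⟩

instance : AddCommGroup (Prolong V) := (equivProd V).addCommGroup

@[simp] theorem coeff0_add (x y : Prolong V) : (x + y).coeff0 = x.coeff0 + y.coeff0 := rfl
@[simp] theorem coeff1_add (x y : Prolong V) : (x + y).coeff1 = x.coeff1 + y.coeff1 := rfl
@[simp] theorem coeff0_zero : (0 : Prolong V).coeff0 = 0 := rfl
@[simp] theorem coeff1_zero : (0 : Prolong V).coeff1 = 0 := rfl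

/-- The left `K`-structure. Since `∂ a = a ∂ + ∂(a)` in `K[∂]`, we have
`a ∂ ⊗ v = ∂ ⊗ a v - 1 ⊗ ∂(a) v`. -/
instance : SMul K (Prolong V) where
  smul a x := ⟨a • x.coeff0 - a′ • x.coeff1, a • x.coeff1⟩

@[simp] theorem coeff0_smul (a : K) (x : Prolong V) :
    (a • x).coeff0 = a • x.coeff0 - a′ • x.coeff1 := rfl
@[simp] theorem coeff1_smul (a : K) (x : Prolong V) : (a • x).coeff1 = a • x.coeff1 := rfl

instance : Module K (Prolong V) where
  one_smul x := by ext <;> simp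
  mul_smul a b x := by
    ext
    · simp only [coeff0_smul, coeff1_smul, Derivation.leibniz, smul_eq_mul, add_smul, mul_smul,
        smul_sub, smul_comm b a′]
      abel
    · simp [mul_smul]
  smul_zero a := by ext <;> simp
  smul_add a x y := by
    ext
    · simp only [coeff0_smul, coeff0_add, coeff1_add, smul_add]; abel
    · simp
  add_smul a b x := by
    ext
    · simp only [coeff0_smul, coeff0_add, map_add, add_smul]; abel
    · simp [add_smul]
  zero_smul x := by ext <;> simp

/-- The inclusion `v ↦ 1 ⊗ v`. -/
def incl (K : Type*) {V : Type*} [Field K] [Differential K] [AddCommGroup V] [Module K V] :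
    V →ₗ[K] Prolong V where
  toFun v := ⟨v, 0⟩
  map_add' v w := by ext <;> simp
  map_smul' a v := by ext <;> simp

/-- The universal derivation `v ↦ ∂ v = ∂ ⊗ v`. -/
def der {V : Type*} [AddCommGroup V] : V →+ Prolong V where
  toFun v := ⟨0, v⟩
  map_add' v w := by ext <;> simp
  map_zero' := rfl

@[simp] theorem coeff0_incl (v : V) : (incl K v).coeff0 = v := rfl
@[simp] theorem coeff1_incl (v : V) : (incl K v).coeff1 = 0 := rfl
@[simp] theorem coeff0_der (v : V) : (der v).coeff0 = 0 := rfl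
@[simp] theorem coeff1_der (v : V) : (der v).coeff1 = v := rfl

theorem der_smul (a : K) (v : V) : der (a • v) = a′ • incl K v + a • der v := by
  ext <;> simp

theorem eq_incl_add_der (x : Prolong V) : x = incl K x.coeff0 + der x.coeff1 := by
  ext <;> simp

/-- The quotient map `V⁽¹⁾ → V`. -/
def proj (K : Type*) {V : Type*} [Field K] [Differential K] [AddCommGroup V] [Module K V] :
    Prolong V →ₗ[K] V where
  toFun x := x.coeff1
  map_add' _ _ := rfl
  map_smul' _ _ := rfl

instance [Module.Finite K V] : Module.Finite K (Prolong V) := by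
  refine ⟨Submodule.fg_of_fg_map_of_fg_inf_ker (proj K) ?_ ?_⟩
  · exact IsNoetherian.noetherian _
  · have h : (⊤ ⊓ LinearMap.ker (proj K) : Submodule K (Prolong V)) =
        Submodule.map (incl K) ⊤ := by
      ext x
      simp only [top_inf_eq, LinearMap.mem_ker, Submodule.map_top, LinearMap.mem_range]
      constructor
      · intro hx
        have hx' : x.coeff1 = 0 := hx
        exact ⟨x.coeff0, by ext <;> simp [hx']⟩
      · rintro ⟨v, rfl⟩
        rfl
    rw [h]
    exact Submodule.FG.map _ Module.Finite.fg_top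

/-- For a Leibniz operator `δ` on `M`, the operator `V ⊗ M → V⁽¹⁾ ⊗ M`,
`v ⊗ m ↦ ∂ v ⊗ m + v ⊗ δ m`. -/
def tensorDer {M : Type*} [AddCommGroup M] [Module K M] (V : Type*) [AddCommGroup V] [Module K V]
    (δ : M →+ M) (hδ : IsLeibniz K δ) : V ⊗[K] M →+ Prolong V ⊗[K] M :=
  TensorProduct.liftAddHom
    (AddMonoidHom.mk' (fun v => AddMonoidHom.mk'
        (fun m => der v ⊗ₜ[K] m + incl K v ⊗ₜ[K] δ m)
        (fun n n' => by simp only [map_add, TensorProduct.tmul_add]; abel))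
      (fun m m' => by
        ext n
        simp only [map_add, TensorProduct.add_tmul, AddMonoidHom.mk'_apply, AddMonoidHom.add_apply]
        abel))
    (fun k v m => by
      simp only [AddMonoidHom.mk'_apply, hδ k m, der_smul, map_smul, TensorProduct.add_tmul,
        TensorProduct.tmul_add, TensorProduct.smul_tmul, TensorProduct.tmul_smul]
      abel)

@[simp] theorem tensorDer_tmul {M : Type*} [AddCommGroup M] [Module K M]
    (δ : M →+ M) (hδ : IsLeibniz K δ) (v : V) (m : M) :
    tensorDer V δ hδ (v ⊗ₜ[K] m) = der v ⊗ₜ[K] m + incl K v ⊗ₜ[K] δ m := rfl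

theorem tensorDer_smul {M : Type*} [AddCommGroup M] [Module K M]
    (δ : M →+ M) (hδ : IsLeibniz K δ) (a : K) (x : V ⊗[K] M) :
    tensorDer V δ hδ (a • x) = a′ • (incl K).rTensor M x + a • tensorDer V δ hδ x := by
  induction x with
  | zero => simp
  | add x y hx hy => simp only [smul_add, map_add, hx, hy]; abel
  | tmul v m =>
    rw [TensorProduct.smul_tmul', tensorDer_tmul, tensorDer_tmul, der_smul]
    simp only [TensorProduct.add_tmul, TensorProduct.smul_tmul', smul_add, map_smul,
      LinearMap.rTensor_tmul]
    abel

/-- For a `∂`-`K`-algebra `B`, the derivation `∂ : B ⊗ V → B ⊗ V⁽¹⁾`,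
`b ⊗ v ↦ b ⊗ ∂ v + ∂(b) ⊗ v`. -/
def baseChangeDer (K : Type*) [Field K] [Differential K] (B : Type*) [CommRing B] [Algebra K B]
    [Differential B] [DifferentialAlgebra K B] (V : Type*) [AddCommGroup V] [Module K V] :
    B ⊗[K] V →+ B ⊗[K] Prolong V :=
  ((TensorProduct.comm K (Prolong V) B).toLinearMap.toAddMonoidHom.comp
    (tensorDer V (derivHom B) (isLeibniz_derivHom K B))).comp
    (TensorProduct.comm K B V).toLinearMap.toAddMonoidHom

@[simp] theorem baseChangeDer_tmul {B : Type*} [CommRing B] [Algebra K B]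
    [Differential B] [DifferentialAlgebra K B] (b : B) (v : V) :
    baseChangeDer K B V (b ⊗ₜ[K] v) = b ⊗ₜ[K] der v + b′ ⊗ₜ[K] incl K v := by
  simp [baseChangeDer]

end Prolong

/-! ### Differential representations -/

/-- Objects of `Rep_G`, `G` being the group represented by `A`: finite dimensional `K`-vector
spaces with a (right) `A`-comodule structure. -/
structure DiffRep (K A : Type u) [Field K] [CommRing A] [HopfAlgebra K A] : Type (u + 1) where
  carrier : Type u
  [addCommGroup : AddCommGroup carrier]
  [module : Module K carrier]
  [finite : Module.Finite K carrier]
  coact : carrier →ₗ[K] carrier ⊗[K] A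
  coassoc : ∀ v, TensorProduct.assoc K carrier A A (coact.rTensor A (coact v)) =
    (Coalgebra.comul (R := K) (A := A)).lTensor carrier (coact v)
  counit : ∀ v, TensorProduct.rid K carrier
    ((Coalgebra.counit (R := K) (A := A)).lTensor carrier (coact v)) = v

namespace DiffRep

attribute [instance] DiffRep.addCommGroup DiffRep.module DiffRep.finite

section Basic

variable {K A : Type u} [Field K] [CommRing A] [HopfAlgebra K A]

instance : CoeSort (DiffRep K A) (Type u) := ⟨DiffRep.carrier⟩

/-- `Hom_G(X, Y)`: linear maps `α` with `ρ_Y ∘ α = (α ⊗ id) ∘ ρ_X`. -/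
structure Hom (X Y : DiffRep K A) where
  toLinearMap : X →ₗ[K] Y
  comm : ∀ v, Y.coact (toLinearMap v) = toLinearMap.rTensor A (X.coact v)

/-- The unit object: `K` with the coaction `1 ↦ 1 ⊗ 1`. -/
abbrev unit (K A : Type u) [Field K] [CommRing A] [HopfAlgebra K A] : DiffRep K A where
  carrier := K
  coact := (TensorProduct.mk K K A).flip 1
  coassoc v := by simp [Algebra.TensorProduct.one_def]
  counit v := by simp

/-- The multiplication `(V ⊗ R) × (W ⊗ R) → (V ⊗ W) ⊗ R`,
`(v ⊗ a) ⊗ (w ⊗ b) ↦ (v ⊗ w) ⊗ a b`. -/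
def mulTensor (K V W R : Type*) [Field K] [AddCommGroup V] [Module K V] [AddCommGroup W]
    [Module K W] [CommRing R] [Algebra K R] :
    (V ⊗[K] R) ⊗[K] (W ⊗[K] R) →ₗ[K] (V ⊗[K] W) ⊗[K] R :=
  (LinearMap.mul' K R).lTensor (V ⊗[K] W) ∘ₗ
    (TensorProduct.tensorTensorTensorComm K V R W R).toLinearMap

@[simp] theorem mulTensor_tmul {K V W R : Type*} [Field K] [AddCommGroup V] [Module K V]
    [AddCommGroup W] [Module K W] [CommRing R] [Algebra K R] (v : V) (w : W) (a b : R) :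
    mulTensor K V W R ((v ⊗ₜ a) ⊗ₜ (w ⊗ₜ b)) = (v ⊗ₜ w) ⊗ₜ (a * b) := by
  simp [mulTensor]

theorem lTensor_mulTensor {K V W R S : Type*} [Field K] [AddCommGroup V] [Module K V]
    [AddCommGroup W] [Module K W] [CommRing R] [Algebra K R] [CommRing S] [Algebra K S]
    (f : R →ₐ[K] S) (x : V ⊗[K] R) (y : W ⊗[K] R) :
    f.toLinearMap.lTensor (V ⊗[K] W) (mulTensor K V W R (x ⊗ₜ y)) =
      mulTensor K V W S (f.toLinearMap.lTensor V x ⊗ₜ f.toLinearMap.lTensor W y) := by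
  induction x with
  | zero => simp
  | add x x' hx hx' => simp only [TensorProduct.add_tmul, map_add, hx, hx']
  | tmul v a =>
    induction y with
    | zero => simp
    | add y y' hy hy' => simp only [TensorProduct.tmul_add, map_add, hy, hy']
    | tmul w b => simp

/-- The coaction `v ⊗ w ↦ ∑ (vᵢ ⊗ wⱼ) ⊗ aᵢ bⱼ` on `X ⊗ Y`, where `ρ_X(v) = ∑ vᵢ ⊗ aᵢ` and
`ρ_Y(w) = ∑ wⱼ ⊗ bⱼ`. -/
def tensorCoact (X Y : DiffRep K A) : X ⊗[K] Y →ₗ[K] (X ⊗[K] Y) ⊗[K] A :=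
  mulTensor K X Y A ∘ₗ TensorProduct.map X.coact Y.coact

theorem tensorCoact_coassoc_aux (X Y : DiffRep K A) (x : X ⊗[K] A) (y : Y ⊗[K] A) :
    TensorProduct.assoc K (X ⊗[K] Y) A A
      ((tensorCoact X Y).rTensor A (mulTensor K X Y A (x ⊗ₜ y))) =
    mulTensor K X Y (A ⊗[K] A)
      (TensorProduct.assoc K X A A (X.coact.rTensor A x) ⊗ₜ
        TensorProduct.assoc K Y A A (Y.coact.rTensor A y)) := by
  induction x with
  | zero => simp
  | add x x' hx hx' => simp only [TensorProduct.add_tmul, map_add, hx, hx']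
  | tmul v a =>
    induction y with
    | zero => simp
    | add y y' hy hy' => simp only [TensorProduct.tmul_add, map_add, hy, hy']
    | tmul w b =>
      simp only [mulTensor_tmul, LinearMap.rTensor_tmul, tensorCoact, LinearMap.comp_apply,
        TensorProduct.map_tmul]
      generalize X.coact v = p
      generalize Y.coact w = q
      induction p with
      | zero => simp
      | add x x' hx hx' => simp only [TensorProduct.add_tmul, map_add, hx, hx']
      | tmul v' a' =>
        induction q with
        | zero => simp
        | add y y' hy hy' =>
          simp only [TensorProduct.tmul_add, TensorProduct.add_tmul, map_add, hy, hy']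
        | tmul w' b' => simp

theorem rid_mulTensor {V W : Type*} [AddCommGroup V] [Module K V] [AddCommGroup W] [Module K W]
    (x : V ⊗[K] K) (y : W ⊗[K] K) :
    TensorProduct.rid K (V ⊗[K] W) (mulTensor K V W K (x ⊗ₜ y)) =
      TensorProduct.rid K V x ⊗ₜ TensorProduct.rid K W y := by
  induction x with
  | zero => simp
  | add x x' hx hx' => simp only [TensorProduct.add_tmul, map_add, hx, hx']
  | tmul v a =>
    induction y with
    | zero => simp
    | add y y' hy hy' => simp only [TensorProduct.tmul_add, map_add, hy, hy']
    | tmul w b =>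
      simp only [mulTensor_tmul, TensorProduct.rid_tmul, TensorProduct.tmul_smul,
        TensorProduct.smul_tmul', mul_smul]
      rw [smul_comm]

/-- The tensor product of representations. -/
abbrev tensor (X Y : DiffRep K A) : DiffRep K A where
  carrier := X ⊗[K] Y
  coact := tensorCoact X Y
  coassoc z := by
    induction z with
    | zero => simp
    | add x y hx hy => simp only [map_add, hx, hy]
    | tmul v w =>
      have h := tensorCoact_coassoc_aux X Y (X.coact v) (Y.coact w)
      rw [X.coassoc, Y.coassoc] at h
      exact h.trans (lTensor_mulTensor (Bialgebra.comulAlgHom K A) _ _).symm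
  counit z := by
    induction z with
    | zero => simp
    | add x y hx hy => simp only [map_add, hx, hy]
    | tmul v w =>
      have h := lTensor_mulTensor (Bialgebra.counitAlgHom K A) (X.coact v) (Y.coact w)
      refine (congrArg (TensorProduct.rid K (X ⊗[K] Y)) h).trans ?_
      rw [rid_mulTensor]
      exact congrArg₂ _ (X.counit v) (Y.counit w)

/-- The `B`-linear action on `B ⊗ X` of a homomorphism `g : A → B`: the `B`-linear extension of
`v ↦ ∑ g(aᵢ) ⊗ vᵢ`, where `ρ(v) = ∑ vᵢ ⊗ aᵢ`. -/
def act {B : Type*} [CommRing B] [Algebra K B] (X : DiffRep K A) (g : A →ₐ[K] B) :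
    B ⊗[K] X →ₗ[B] B ⊗[K] X :=
  LinearMap.liftBaseChange B
    ((TensorProduct.comm K X B).toLinearMap ∘ₗ g.toLinearMap.lTensor X ∘ₗ X.coact)

end Basic

section Prolongation

variable {K A : Type u} [Field K] [Differential K] [CommRing A] [HopfAlgebra K A]
  [Differential A] [DiffHopfAlgebra K A]

/-- The operator `v ⊗ a ↦ ∂ v ⊗ a + v ⊗ ∂ a` from `V ⊗ A` to `V⁽¹⁾ ⊗ A`. -/
def coactDer (K A V : Type*) [Field K] [Differential K] [CommRing A] [Algebra K A]
    [Differential A] [DifferentialAlgebra K A] [AddCommGroup V] [Module K V] :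
    V ⊗[K] A →+ Prolong V ⊗[K] A :=
  Prolong.tensorDer V (derivHom A) (isLeibniz_derivHom K A)

/-- The prolonged coaction on `X⁽¹⁾`, characterized by `ρ(1 ⊗ v) = ρ(v)` and
`ρ(∂ v) = ∂ (ρ v)`. -/
def prolongCoact (X : DiffRep K A) : Prolong X →ₗ[K] Prolong X ⊗[K] A where
  toFun x := (Prolong.incl K).rTensor A (X.coact x.coeff0) + coactDer K A X (X.coact x.coeff1)
  map_add' x y := by
    simp only [Prolong.coeff0_add, Prolong.coeff1_add, map_add]; abel
  map_smul' a x := by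
    simp only [Prolong.coeff0_smul, Prolong.coeff1_smul, map_sub, map_smul, coactDer,
      Prolong.tensorDer_smul, RingHom.id_apply, smul_add]
    abel

theorem prolongCoact_incl (X : DiffRep K A) (v : X) :
    prolongCoact X (Prolong.incl K v) = (Prolong.incl K).rTensor A (X.coact v) := by
  simp [prolongCoact]

theorem prolongCoact_der (X : DiffRep K A) (v : X) :
    prolongCoact X (Prolong.der v) = coactDer K A X (X.coact v) := by
  simp [prolongCoact]

theorem prolong_coassoc_incl (X : DiffRep K A) (x : X ⊗[K] A) :
    TensorProduct.assoc K (Prolong X) A A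
      ((prolongCoact X).rTensor A ((Prolong.incl K).rTensor A x)) =
    (Prolong.incl K).rTensor (A ⊗[K] A) (TensorProduct.assoc K X A A (X.coact.rTensor A x)) := by
  induction x with
  | zero => simp
  | add x y hx hy => simp only [map_add, hx, hy]
  | tmul v a =>
    simp only [LinearMap.rTensor_tmul, prolongCoact_incl]
    generalize X.coact v = p
    induction p with
    | zero => simp
    | add x y hx hy => simp only [map_add, TensorProduct.add_tmul, hx, hy]
    | tmul w b => simp

theorem prolong_coassoc_der (X : DiffRep K A) (x : X ⊗[K] A) :
    TensorProduct.assoc K (Prolong X) A A ((prolongCoact X).rTensor A (coactDer K A X x)) =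
    Prolong.tensorDer X (tensorDeriv K A A) (isLeibniz_tensorDeriv K A A)
      (TensorProduct.assoc K X A A (X.coact.rTensor A x)) := by
  induction x with
  | zero => simp
  | add x y hx hy => simp only [map_add, hx, hy]
  | tmul v a =>
    simp only [coactDer, Prolong.tensorDer_tmul, map_add, LinearMap.rTensor_tmul,
      prolongCoact_incl, prolongCoact_der]
    generalize X.coact v = p
    induction p with
    | zero => simp
    | add x y hx hy =>
      simp only [map_add, TensorProduct.add_tmul] at hx hy ⊢
      rw [← hx, ← hy]
      abel
    | tmul w b =>
      simp only [Prolong.tensorDer_tmul, TensorProduct.add_tmul, map_add, LinearMap.rTensor_tmul,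
        TensorProduct.assoc_tmul, tensorDeriv, tensorLeibniz_tmul, TensorProduct.tmul_add]
      abel

theorem lTensor_coactDer (X : DiffRep K A) (x : X ⊗[K] A) :
    (Coalgebra.comul (R := K) (A := A)).lTensor (Prolong X) (coactDer K A X x) =
    Prolong.tensorDer X (tensorDeriv K A A) (isLeibniz_tensorDeriv K A A)
      ((Coalgebra.comul (R := K) (A := A)).lTensor X x) := by
  induction x with
  | zero => simp
  | add x y hx hy => simp only [map_add, hx, hy]
  | tmul v a =>
    simp only [coactDer, Prolong.tensorDer_tmul, map_add, LinearMap.lTensor_tmul, derivHom_apply,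
      DiffHopfAlgebra.comul_deriv]

theorem lTensor_incl {M N : Type*} [AddCommGroup M] [Module K M] [AddCommGroup N] [Module K N]
    (X : DiffRep K A) (f : M →ₗ[K] N) (x : X ⊗[K] M) :
    f.lTensor (Prolong X) ((Prolong.incl K).rTensor M x) =
      (Prolong.incl K).rTensor N (f.lTensor X x) := by
  induction x with
  | zero => simp
  | add x y hx hy => simp only [map_add, hx, hy]
  | tmul v a => simp

theorem rid_coactDer (X : DiffRep K A) (x : X ⊗[K] A) :
    TensorProduct.rid K (Prolong X)
      ((Coalgebra.counit (R := K) (A := A)).lTensor (Prolong X) (coactDer K A X x)) =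
    Prolong.der (TensorProduct.rid K X
      ((Coalgebra.counit (R := K) (A := A)).lTensor X x)) := by
  induction x with
  | zero => simp
  | add x y hx hy => simp only [map_add, hx, hy]
  | tmul v a =>
    simp [coactDer, DiffHopfAlgebra.counit_deriv, Prolong.der_smul]
    abel

theorem rid_incl (X : DiffRep K A) (x : X ⊗[K] K) :
    TensorProduct.rid K (Prolong X) ((Prolong.incl K).rTensor K x) =
      Prolong.incl K (TensorProduct.rid K X x) := by
  induction x with
  | zero => simp
  | add x y hx hy => simp only [map_add, hx, hy]
  | tmul v a => simp

/-- The prolongation `X⁽¹⁾` of a representation. -/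
abbrev prolong (X : DiffRep K A) : DiffRep K A where
  carrier := Prolong X
  coact := prolongCoact X
  coassoc x := by
    rw [Prolong.eq_incl_add_der (K := K) x]
    simp only [map_add, prolongCoact_incl, prolongCoact_der, prolong_coassoc_incl,
      prolong_coassoc_der, X.coassoc, lTensor_coactDer, lTensor_incl]
  counit x := by
    obtain ⟨v, w, rfl⟩ : ∃ v w : X, x = Prolong.incl K v + Prolong.der w :=
      ⟨_, _, Prolong.eq_incl_add_der x⟩
    simp only [map_add, prolongCoact_incl, prolongCoact_der, rid_coactDer, lTensor_incl, rid_incl,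
      X.counit]

/-- The inclusion `X → X⁽¹⁾` is a morphism of representations. -/
def inclHom (X : DiffRep K A) : Hom X X.prolong where
  toLinearMap := Prolong.incl K
  comm v := prolongCoact_incl X v

end Prolongation

end DiffRep

/-! ### The group functor of differential tensor automorphisms -/

/-- The canonical `B`-bilinear map `(B ⊗ V) × (B ⊗ W) → (B ⊗ V) ⊗_B (B ⊗ W) ≅ B ⊗ (V ⊗ W)`. -/
def pair {K V W : Type*} (B : Type*) [Field K] [AddCommGroup V] [Module K V]
    [AddCommGroup W] [Module K W] [CommRing B] [Algebra K B] (x : B ⊗[K] V) (y : B ⊗[K] W) :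
    B ⊗[K] (V ⊗[K] W) :=
  (TensorProduct.AlgebraTensorModule.distribBaseChange K B V W).symm (x ⊗ₜ[B] y)

@[simp] theorem pair_tmul {K V W B : Type*} [Field K] [AddCommGroup V] [Module K V]
    [AddCommGroup W] [Module K W] [CommRing B] [Algebra K B] (b c : B) (v : V) (w : W) :
    pair B (b ⊗ₜ[K] v) (c ⊗ₜ[K] w) = (b * c) ⊗ₜ[K] (v ⊗ₜ[K] w) := by
  rw [pair, LinearEquiv.symm_apply_eq,
    TensorProduct.AlgebraTensorModule.distribBaseChange_tmul]
  rw [show c ⊗ₜ[K] w = c • ((1 : B) ⊗ₜ[K] w) by simp [TensorProduct.smul_tmul'],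
    TensorProduct.tmul_smul, TensorProduct.smul_tmul', TensorProduct.smul_tmul', smul_eq_mul,
    mul_comm]

section Aut

variable {K A : Type u} [Field K] [Differential K] [CommRing A] [HopfAlgebra K A]
  [Differential A] [DiffHopfAlgebra K A]

/-- The families `(λ_X)` of `B`-linear automorphisms of `B ⊗ ω(X)`, `X ∈ Ob(Rep_G)`, that form
`Aut^{⊗,∂}(ω)(B)`. -/
structure IsDiffTensorAut {B : Type*} [CommRing B] [Algebra K B] [Differential B]
    [DifferentialAlgebra K B]
    (l : ∀ X : DiffRep K A, (B ⊗[K] X) ≃ₗ[B] (B ⊗[K] X)) : Prop where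
  /-- `λ_{X ⊗ Y} = λ_X ⊗ λ_Y` -/
  tensor : ∀ (X Y : DiffRep K A) (x : B ⊗[K] X) (y : B ⊗[K] Y),
    l (X.tensor Y) (pair B x y) = pair B (l X x) (l Y y)
  /-- `λ_1 = id` -/
  unit : ∀ x : B ⊗[K] (DiffRep.unit K A), l (DiffRep.unit K A) x = x
  /-- `λ_Y ∘ (id ⊗ α) = (id ⊗ α) ∘ λ_X` for `α ∈ Hom_G(X, Y)` -/
  natural : ∀ (X Y : DiffRep K A) (α : DiffRep.Hom X Y) (x : B ⊗[K] X),
    l Y (α.toLinearMap.baseChange B x) = α.toLinearMap.baseChange B (l X x)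
  /-- `∂ ∘ λ_X = λ_{X⁽¹⁾} ∘ ∂` -/
  deriv : ∀ (X : DiffRep K A) (x : B ⊗[K] X),
    Prolong.baseChangeDer K B X (l X x) = l X.prolong (Prolong.baseChangeDer K B X x)

/-- The group `Aut^{⊗,∂}(ω)(B)`; the group law is composition in each component. -/
def diffTensorAut (K A : Type u) [Field K] [Differential K] [CommRing A] [HopfAlgebra K A]
    [Differential A] [DiffHopfAlgebra K A] (B : Type*) [CommRing B] [Algebra K B] [Differential B]
    [DifferentialAlgebra K B] :
    Subgroup (∀ X : DiffRep K A, (B ⊗[K] X) ≃ₗ[B] (B ⊗[K] X)) where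
  carrier := {l | IsDiffTensorAut l}
  one_mem' := ⟨fun _ _ _ _ => rfl, fun _ => rfl, fun _ _ _ _ => rfl, fun _ _ => rfl⟩
  mul_mem' {l m} hl hm :=
    { tensor := fun X Y x y => by
        simp only [Pi.mul_apply, LinearEquiv.mul_apply, hm.tensor, hl.tensor]
      unit := fun x => by
        simp only [Pi.mul_apply, LinearEquiv.mul_apply, hm.unit, hl.unit]
      natural := fun X Y α x => by
        simp only [Pi.mul_apply, LinearEquiv.mul_apply, hm.natural, hl.natural]
      deriv := fun X x => by
        simp only [Pi.mul_apply, LinearEquiv.mul_apply, hm.deriv, hl.deriv] }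
  inv_mem' {l} hl :=
    { tensor := fun X Y x y => by
        change (l (X.tensor Y)).symm _ = pair B ((l X).symm x) ((l Y).symm y)
        rw [LinearEquiv.symm_apply_eq, hl.tensor]
        simp
      unit := fun x => by
        change (l (DiffRep.unit K A)).symm _ = _
        rw [LinearEquiv.symm_apply_eq, hl.unit]
      natural := fun X Y α x => by
        change (l Y).symm _ = α.toLinearMap.baseChange B ((l X).symm x)
        rw [LinearEquiv.symm_apply_eq, hl.natural]
        simp
      deriv := fun X x => by
        change Prolong.baseChangeDer K B X ((l X).symm x) = (l X.prolong).symm _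
        rw [LinearEquiv.eq_symm_apply, ← hl.deriv]
        simp }

variable {B C D : Type*} [CommRing B] [Algebra K B] [Differential B] [DifferentialAlgebra K B]
  [CommRing C] [Algebra K C] [Differential C] [DifferentialAlgebra K C]
  [CommRing D] [Algebra K D] [Differential D] [DifferentialAlgebra K D]

/-- For `φ : B → C` and a `B`-linear endomorphism `f` of `B ⊗ V`, the `C`-linear extension to
`C ⊗ V` of `v ↦ (φ ⊗ id)(f (1 ⊗ v))`. -/
def extendScalars {V : Type*} [AddCommGroup V] [Module K V] (φ : B →ₐ[K] C)
    (f : B ⊗[K] V →ₗ[B] B ⊗[K] V) : C ⊗[K] V →ₗ[C] C ⊗[K] V :=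
  LinearMap.liftBaseChange C
    (φ.toLinearMap.rTensor V ∘ₗ f.restrictScalars K ∘ₗ TensorProduct.mk K B V 1)

section Extend

variable {V W : Type*} [AddCommGroup V] [Module K V] [AddCommGroup W] [Module K W]

theorem rTensor_smul (φ : B →ₐ[K] C) (b : B) (x : B ⊗[K] V) :
    φ.toLinearMap.rTensor V (b • x) = φ b • φ.toLinearMap.rTensor V x := by
  induction x with
  | zero => simp
  | add x y hx hy => simp only [smul_add, map_add, hx, hy]
  | tmul c v => simp [TensorProduct.smul_tmul']

theorem extendScalars_tmul (φ : B →ₐ[K] C) (f : B ⊗[K] V →ₗ[B] B ⊗[K] V) (c : C) (v : V) :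
    extendScalars φ f (c ⊗ₜ v) = c • φ.toLinearMap.rTensor V (f (1 ⊗ₜ v)) := by
  simp [extendScalars]

theorem extendScalars_rTensor (φ : B →ₐ[K] C) (f : B ⊗[K] V →ₗ[B] B ⊗[K] V) (x : B ⊗[K] V) :
    extendScalars φ f (φ.toLinearMap.rTensor V x) = φ.toLinearMap.rTensor V (f x) := by
  induction x with
  | zero => simp
  | add x y hx hy => simp only [map_add, hx, hy]
  | tmul b v =>
    rw [LinearMap.rTensor_tmul, extendScalars_tmul, AlgHom.toLinearMap_apply, ← rTensor_smul,
      ← map_smul, TensorProduct.smul_tmul', smul_eq_mul, mul_one]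

theorem tmul_eq_smul_rTensor (φ : B →ₐ[K] C) (c : C) (v : V) :
    c ⊗ₜ[K] v = c • φ.toLinearMap.rTensor V ((1 : B) ⊗ₜ[K] v) := by
  simp [TensorProduct.smul_tmul']

theorem extendScalars_comp (φ : B →ₐ[K] C) (f g : B ⊗[K] V →ₗ[B] B ⊗[K] V) (x : C ⊗[K] V) :
    extendScalars φ (f ∘ₗ g) x = extendScalars φ f (extendScalars φ g x) := by
  induction x with
  | zero => simp
  | add x y hx hy => simp only [map_add, hx, hy]
  | tmul c v => simp only [extendScalars_tmul, map_smul, extendScalars_rTensor, LinearMap.comp_apply]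

theorem extendScalars_id (φ : B →ₐ[K] C) (x : C ⊗[K] V) :
    extendScalars φ (LinearMap.id : B ⊗[K] V →ₗ[B] B ⊗[K] V) x = x := by
  induction x with
  | zero => simp
  | add x y hx hy => simp only [map_add, hx, hy]
  | tmul c v => simp only [extendScalars_tmul, LinearMap.id_apply, ← tmul_eq_smul_rTensor]

/-- `extendScalars` for automorphisms. -/
def extendScalarsEquiv (φ : B →ₐ[K] C) (e : (B ⊗[K] V) ≃ₗ[B] (B ⊗[K] V)) :
    (C ⊗[K] V) ≃ₗ[C] (C ⊗[K] V) :=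
  LinearEquiv.ofLinearMap (extendScalars φ e.toLinearMap) (extendScalars φ e.symm.toLinearMap)
    (LinearMap.ext fun x => by
      rw [LinearMap.comp_apply, ← extendScalars_comp, LinearEquiv.comp_symm, extendScalars_id]
      rfl)
    (LinearMap.ext fun x => by
      rw [LinearMap.comp_apply, ← extendScalars_comp, LinearEquiv.symm_comp, extendScalars_id]
      rfl)

@[simp] theorem extendScalarsEquiv_apply (φ : B →ₐ[K] C) (e : (B ⊗[K] V) ≃ₗ[B] (B ⊗[K] V))
    (x : C ⊗[K] V) : extendScalarsEquiv φ e x = extendScalars φ e.toLinearMap x := rfl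

theorem rTensor_pair (φ : B →ₐ[K] C) (x : B ⊗[K] V) (y : B ⊗[K] W) :
    φ.toLinearMap.rTensor (V ⊗[K] W) (pair B x y) =
      pair C (φ.toLinearMap.rTensor V x) (φ.toLinearMap.rTensor W y) := by
  induction x with
  | zero => simp [pair]
  | add x x' hx hx' =>
    simp only [pair, TensorProduct.add_tmul, map_add] at hx hx' ⊢
    rw [hx, hx']
  | tmul v a =>
    induction y with
    | zero => simp [pair]
    | add y y' hy hy' =>
      simp only [pair, TensorProduct.tmul_add, map_add] at hy hy' ⊢
      rw [hy, hy']
    | tmul w b => simp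

theorem pair_smul_smul (b c : C) (x : C ⊗[K] V) (y : C ⊗[K] W) :
    pair C (b • x) (c • y) = (b * c) • pair C x y := by
  simp only [pair, TensorProduct.tmul_smul, ← TensorProduct.smul_tmul', map_smul, smul_smul,
    mul_comm]

theorem rTensor_baseChange (φ : B →ₐ[K] C) (α : V →ₗ[K] W) (x : B ⊗[K] V) :
    φ.toLinearMap.rTensor W (α.baseChange B x) = α.baseChange C (φ.toLinearMap.rTensor V x) := by
  induction x with
  | zero => simp
  | add x y hx hy => simp only [map_add, hx, hy]
  | tmul b v => simp

theorem rTensor_baseChangeDer (φ : DiffAlgHom K B C) (x : B ⊗[K] V) :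
    φ.toAlgHom.toLinearMap.rTensor (Prolong V) (Prolong.baseChangeDer K B V x) =
      Prolong.baseChangeDer K C V (φ.toAlgHom.toLinearMap.rTensor V x) := by
  induction x with
  | zero => simp
  | add x y hx hy => simp only [map_add, hx, hy]
  | tmul b v => simp [φ.map_deriv]

theorem baseChangeDer_smul (c : C) (x : C ⊗[K] V) :
    Prolong.baseChangeDer K C V (c • x) =
      c′ • (Prolong.incl K).baseChange C x + c • Prolong.baseChangeDer K C V x := by
  induction x with
  | zero => simp
  | add x y hx hy => simp only [smul_add, map_add, hx, hy]; abel
  | tmul b v =>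
    simp only [TensorProduct.smul_tmul', smul_eq_mul, Prolong.baseChangeDer_tmul,
      LinearMap.baseChange_tmul, smul_add, Derivation.leibniz, TensorProduct.add_tmul]
    rw [mul_comm b c′]
    abel

end Extend

theorem IsDiffTensorAut.extend (φ : DiffAlgHom K B C)
    {l : ∀ X : DiffRep K A, (B ⊗[K] X) ≃ₗ[B] (B ⊗[K] X)} (hl : IsDiffTensorAut l) :
    IsDiffTensorAut (fun X => extendScalarsEquiv φ.toAlgHom (l X)) where
  tensor X Y x y := by
    induction x with
    | zero => simp [pair]
    | add x x' hx hx' =>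
      simp only [pair, TensorProduct.add_tmul, map_add] at hx hx' ⊢
      rw [hx, hx']
    | tmul b v =>
      induction y with
      | zero => simp [pair]
      | add y y' hy hy' =>
        simp only [pair, TensorProduct.tmul_add, map_add] at hy hy' ⊢
        rw [hy, hy']
      | tmul c w =>
        have h := hl.tensor X Y (1 ⊗ₜ v) (1 ⊗ₜ w)
        simp only [pair_tmul, mul_one] at h
        simp only [pair_tmul, extendScalarsEquiv_apply, extendScalars_tmul, pair_smul_smul,
          LinearEquiv.coe_coe]
        rw [← rTensor_pair, ← h]
  unit x := by
    induction x with
    | zero => simp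
    | add x y hx hy => simp only [map_add, hx, hy]
    | tmul c v =>
      rw [extendScalarsEquiv_apply, extendScalars_tmul, LinearEquiv.coe_coe, hl.unit,
        ← tmul_eq_smul_rTensor]
  natural X Y α x := by
    induction x with
    | zero => simp
    | add x y hx hy => simp only [map_add, hx, hy]
    | tmul c v =>
      have h := hl.natural X Y α (1 ⊗ₜ v)
      simp only [LinearMap.baseChange_tmul] at h
      simp only [LinearMap.baseChange_tmul, extendScalarsEquiv_apply, extendScalars_tmul, map_smul,
        ← rTensor_baseChange, LinearEquiv.coe_coe]
      rw [h]
  deriv X x := by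
    induction x with
    | zero => simp
    | add x y hx hy => simp only [map_add, hx, hy]
    | tmul c v =>
      have h := hl.deriv X (1 ⊗ₜ v)
      have h2 := hl.natural X X.prolong X.inclHom (1 ⊗ₜ v)
      rw [tmul_eq_smul_rTensor φ.toAlgHom c v]
      simp only [extendScalarsEquiv_apply, map_smul, extendScalars_rTensor, LinearEquiv.coe_coe,
        baseChangeDer_smul, map_add, ← rTensor_baseChangeDer, ← rTensor_baseChange]
      rw [h]
      exact congrArg (fun z => c′ • φ.toAlgHom.toLinearMap.rTensor (Prolong X) z + _) h2.symm

/-- `Aut^{⊗,∂}(ω)(φ) : Aut^{⊗,∂}(ω)(B) → Aut^{⊗,∂}(ω)(C)` for `φ : B → C`. -/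
def diffTensorAutMap (φ : DiffAlgHom K B C) : diffTensorAut K A B →* diffTensorAut K A C where
  toFun l := ⟨fun X => extendScalarsEquiv φ.toAlgHom (l.1 X), l.2.extend φ⟩
  map_one' := Subtype.ext (funext fun _ => LinearEquiv.ext fun x =>
    extendScalars_id φ.toAlgHom x)
  map_mul' l m := Subtype.ext (funext fun X => LinearEquiv.ext fun x =>
    extendScalars_comp φ.toAlgHom (l.1 X).toLinearMap (m.1 X).toLinearMap x)

theorem diffTensorAutMap_id (l : diffTensorAut K A B) :
    diffTensorAutMap (DiffAlgHom.id K B) l = l := by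
  refine Subtype.ext (funext fun X => LinearEquiv.ext fun x => ?_)
  change extendScalars (AlgHom.id K B) (l.1 X).toLinearMap x = l.1 X x
  induction x with
  | zero => simp
  | add x y hx hy => simp only [map_add, hx, hy]
  | tmul b v =>
    rw [extendScalars_tmul]
    change b • (LinearMap.id.rTensor X) (l.1 X (1 ⊗ₜ v)) = _
    rw [LinearMap.rTensor_id, LinearMap.id_apply, ← map_smul, TensorProduct.smul_tmul',
      smul_eq_mul, mul_one]

theorem diffTensorAutMap_comp (φ : DiffAlgHom K B C) (ψ : DiffAlgHom K C D)
    (l : diffTensorAut K A B) :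
    diffTensorAutMap (ψ.comp φ) l = diffTensorAutMap ψ (diffTensorAutMap φ l) := by
  refine Subtype.ext (funext fun X => LinearEquiv.ext fun x => ?_)
  change extendScalars (ψ.toAlgHom.comp φ.toAlgHom) (l.1 X).toLinearMap x =
    extendScalars ψ.toAlgHom (extendScalars φ.toAlgHom (l.1 X).toLinearMap) x
  induction x with
  | zero => simp
  | add x y hx hy => simp only [map_add, hx, hy]
  | tmul b v =>
    rw [extendScalars_tmul, extendScalars_tmul, extendScalars_tmul, one_smul,
      AlgHom.comp_toLinearMap, LinearMap.rTensor_comp_apply]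

end Aut

/-- The group functor `Aut^{⊗,∂}(ω) : B ↦ Aut^{⊗,∂}(ω)(B)` on `∂`-`K`-algebras. -/
def diffTensorAutFunctor (K A : Type u) [Field K] [Differential K] [CommRing A] [HopfAlgebra K A]
    [Differential A] [DiffHopfAlgebra K A] : DiffAlg K ⥤ GrpCat.{u + 1} where
  obj B := GrpCat.of (diffTensorAut K A B)
  map φ := GrpCat.ofHom (diffTensorAutMap φ)
  map_id _ := GrpCat.hom_ext (MonoidHom.ext fun l => diffTensorAutMap_id l)
  map_comp φ ψ := GrpCat.hom_ext (MonoidHom.ext fun l => diffTensorAutMap_comp φ ψ l)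

end DiffTannaka

end

/-! The point is recovered from its matrix coefficients. For a representation X, a functional f on X
and v in X, put c_f(v) = (f ⊗ id)(ρ(v)) in A. A point g acts on X with entries f(g·v) = g(c_f(v))
(`baseFunctional_act`). That these actions form a differential tensor automorphism restates the
axioms: the counit law gives the identity, coassociativity the product, multiplicativity of g the
tensor condition, and compatibility of g with ∂ the prolongation condition.

Conversely, let a family λ be given. Every a in A lies in a finite dimensional subcomodule V
(`exists_isSubcomodule_mem`), and the counit law makes a itself a coefficient: c_ε(a) = a on V
(`coefficient_counitOn`). This forces γ(a) = ε(λ_V(1 ⊗ a)) and gives injectivity. Naturality along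
inclusions makes γ independent of V (`IsDiffTensorAut.pointValue_eq`).

The key identity is γ(c_f(v)) = f(λ_X(1 ⊗ v)) for all X, f and v
(`IsDiffTensorAut.pointValue_coefficient`): c_f is a comodule map from X onto a subcomodule of A and
ε ∘ c_f = f, so naturality along c_f applies. Each property of γ then follows by realising an
element of A as a coefficient: 1 from the unit object, ab from V ⊗ W, and ∂a from the prolongation
of V. Since functionals separate the elements of B ⊗ X, the same identity shows that γ acts on every
X as λ_X. -/

noncomputable section

set_option linter.unusedSectionVars false

namespace DiffTannaka

/-! ### Scalar extension of linear functionals -/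

section BaseFunctional

variable {K V W : Type*} [Field K] [AddCommGroup V] [Module K V] [AddCommGroup W] [Module K W]
  {B : Type*} [CommRing B] [Algebra K B]

/-- The `B`-linear extension `B ⊗ V → B` of a linear functional on `V`. -/
def baseFunctional (B : Type*) [CommRing B] [Algebra K B] (f : V →ₗ[K] K) : B ⊗[K] V →ₗ[B] B :=
  LinearMap.liftBaseChange B (Algebra.linearMap K B ∘ₗ f)

@[simp] theorem baseFunctional_tmul (f : V →ₗ[K] K) (b : B) (v : V) :
    baseFunctional B f (b ⊗ₜ v) = b * algebraMap K B (f v) := by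
  simp [baseFunctional]

theorem baseFunctional_baseChange (f : W →ₗ[K] K) (α : V →ₗ[K] W) (x : B ⊗[K] V) :
    baseFunctional B f (α.baseChange B x) = baseFunctional B (f ∘ₗ α) x := by
  induction x with
  | zero => simp
  | add x y hx hy => simp only [map_add, hx, hy]
  | tmul b v => simp

/-- Turns the tensor condition on λ into multiplicativity of the recovered point. -/
theorem baseFunctional_pair (f : V →ₗ[K] K) (f' : W →ₗ[K] K) (x : B ⊗[K] V) (y : B ⊗[K] W) :
    baseFunctional B (LinearMap.mul' K K ∘ₗ TensorProduct.map f f') (pair B x y) =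
      baseFunctional B f x * baseFunctional B f' y := by
  induction x with
  | zero => simp [pair]
  | add x x' hx hx' =>
    simp only [pair, TensorProduct.add_tmul, map_add, add_mul] at hx hx' ⊢
    rw [hx, hx']
  | tmul b v =>
    induction y with
    | zero => simp [pair]
    | add y y' hy hy' =>
      simp only [pair, TensorProduct.tmul_add, map_add, mul_add] at hy hy' ⊢
      rw [hy, hy']
    | tmul c w => simp; ring

/-- Linear functionals on `V` separate the elements of `B ⊗ V`. -/
theorem eq_of_baseFunctional_eq [Module.Finite K V] {x y : B ⊗[K] V}
    (h : ∀ f : V →ₗ[K] K, baseFunctional B f x = baseFunctional B f y) : x = y := by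
  let e := Module.finBasis K V
  -- The coordinates in the base-changed basis are the scalar extensions of the dual basis
  -- functionals.
  have key : ∀ (z : B ⊗[K] V) i, (e.baseChange B).repr z i = baseFunctional B (e.coord i) z := by
    intro z i
    induction z with
    | zero => simp
    | add x y hx hy => simp only [map_add, Finsupp.add_apply, hx, hy]
    | tmul b v => simp [Algebra.smul_def, mul_comm]
  refine (e.baseChange B).repr.injective (Finsupp.ext fun i => ?_)
  rw [key, key, h]

end BaseFunctional

/-! ### The action of points on representations -/

namespace DiffRep

/-! ### Matrix coefficients and the action of algebra homomorphisms -/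

section Coefficient

variable {K A : Type u} [Field K] [CommRing A] [HopfAlgebra K A]

/-- The coefficient map `v ↦ (f ⊗ id)(ρ(v))` of a linear functional `f` on `X`. -/
def coefficient (X : DiffRep K A) (f : X →ₗ[K] K) : X →ₗ[K] A :=
  (TensorProduct.lid K A).toLinearMap ∘ₗ f.rTensor A ∘ₗ X.coact

theorem coefficient_apply (X : DiffRep K A) (f : X →ₗ[K] K) (v : X) :
    X.coefficient f v = TensorProduct.lid K A (f.rTensor A (X.coact v)) := rfl

/-- The maps f and ε act on different legs of ρ(v), so the counit axiom of X applies. Thus every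
functional on X factors through A as ε ∘ c_f. -/
theorem counit_coefficient (X : DiffRep K A) (f : X →ₗ[K] K) (v : X) :
    Coalgebra.counit (R := K) (X.coefficient f v) = f v := by
  -- Expanding only this v makes both sides additive functions of ρ(v), so pure tensors suffice.
  conv_rhs => rw [← X.counit v]
  rw [coefficient_apply]
  generalize X.coact v = p
  induction p with
  | zero => simp
  | add x y hx hy => simp only [map_add, hx, hy]
  | tmul w a => simp [mul_comm]

/-- The coefficient map is a comodule homomorphism to `A`. -/
theorem comul_coefficient (X : DiffRep K A) (f : X →ₗ[K] K) (v : X) :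
    Coalgebra.comul (R := K) (X.coefficient f v) = (X.coefficient f).rTensor A (X.coact v) := by
  -- Exhibits (ρ ⊗ id)(p). For p = ρ(v), coassociativity replaces it by (id ⊗ Δ)(ρ(v)), on which f
  -- only touches the first leg.
  have h1 : ∀ p : X ⊗[K] A, (X.coefficient f).rTensor A p =
      TensorProduct.lid K (A ⊗[K] A) (f.rTensor (A ⊗[K] A)
        (TensorProduct.assoc K X A A (X.coact.rTensor A p))) := by
    intro p
    induction p with
    | zero => simp
    | add x y hx hy => simp only [map_add, hx, hy]
    | tmul w a =>
      rw [LinearMap.rTensor_tmul, LinearMap.rTensor_tmul, coefficient_apply]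
      generalize X.coact w = q
      induction q with
      | zero => simp
      | add x y hx hy => simp only [map_add, TensorProduct.add_tmul, hx, hy]
      | tmul w' a' => simp [TensorProduct.smul_tmul']
  rw [h1, X.coassoc, coefficient_apply]
  generalize X.coact v = p
  induction p with
  | zero => simp
  | add x y hx hy => simp only [map_add, hx, hy]
  | tmul w a => simp

variable {B : Type*} [CommRing B] [Algebra K B]

theorem act_tmul (X : DiffRep K A) (g : A →ₐ[K] B) (b : B) (v : X) :
    X.act g (b ⊗ₜ v) =
      b • TensorProduct.comm K X B (g.toLinearMap.lTensor X (X.coact v)) := by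
  simp [act]

/-- The matrix entries of the action of g are the values of g at the matrix coefficients of X. -/
theorem baseFunctional_act (X : DiffRep K A) (g : A →ₐ[K] B) (f : X →ₗ[K] K) (v : X) :
    baseFunctional B f (X.act g (1 ⊗ₜ v)) = g (X.coefficient f v) := by
  rw [act_tmul, one_smul, coefficient_apply]
  generalize X.coact v = p
  induction p with
  | zero => simp
  | add x y hx hy => simp only [map_add, hx, hy]
  | tmul w a => simp [Algebra.smul_def, mul_comm]

/-- `B`-linear maps out of `B ⊗ V` agree if they agree on `1 ⊗ v`. -/
theorem linearMap_ext_one_tmul {V N : Type*} [AddCommGroup V] [Module K V] [AddCommGroup N]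
    [Module B N] {f g : B ⊗[K] V →ₗ[B] N}
    (h : ∀ v, f (1 ⊗ₜ v) = g (1 ⊗ₜ v)) : f = g := by
  refine LinearMap.ext fun x => ?_
  induction x with
  | zero => simp
  | add x y hx hy => simp only [map_add, hx, hy]
  | tmul b v =>
    rw [show b ⊗ₜ[K] v = b • ((1 : B) ⊗ₜ[K] v) by simp [TensorProduct.smul_tmul'], map_smul,
      map_smul, h]

theorem act_natural {X Y : DiffRep K A} (g : A →ₐ[K] B) (α : Hom X Y) (x : B ⊗[K] X) :
    Y.act g (α.toLinearMap.baseChange B x) = α.toLinearMap.baseChange B (X.act g x) := by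
  induction x with
  | zero => simp
  | add x y hx hy => simp only [map_add, hx, hy]
  | tmul b v =>
    rw [LinearMap.baseChange_tmul, act_tmul, act_tmul, α.comm, map_smul]
    generalize X.coact v = p
    congr 1
    induction p with
    | zero => simp
    | add x y hx hy => simp only [map_add, hx, hy]
    | tmul w a => simp

theorem act_unit (g : A →ₐ[K] B) (x : B ⊗[K] unit K A) : (unit K A).act g x = x := by
  induction x with
  | zero => simp
  | add x y hx hy => simp only [map_add, hx, hy]
  | tmul b v => rw [act_tmul]; simp [TensorProduct.smul_tmul']

/-- The coaction on X ⊗ Y multiplies coefficients, and g is multiplicative; this enters through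
`lTensor_mulTensor`. -/
theorem act_tensor (X Y : DiffRep K A) (g : A →ₐ[K] B) (x : B ⊗[K] X) (y : B ⊗[K] Y) :
    (X.tensor Y).act g (pair B x y) = pair B (X.act g x) (Y.act g y) := by
  induction x with
  | zero => simp [pair]
  | add x x' hx hx' =>
    simp only [pair, TensorProduct.add_tmul, map_add] at hx hx' ⊢
    rw [hx, hx']
  | tmul b v =>
    induction y with
    | zero => simp [pair]
    | add y y' hy hy' =>
      simp only [pair, TensorProduct.tmul_add, map_add] at hy hy' ⊢
      rw [hy, hy']
    | tmul c w =>
      rw [pair_tmul, act_tmul, act_tmul, act_tmul]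
      have hc : (X.tensor Y).coact (v ⊗ₜ w) = mulTensor K X Y A (X.coact v ⊗ₜ Y.coact w) := rfl
      rw [hc, lTensor_mulTensor]
      generalize g.toLinearMap.lTensor X (X.coact v) = p
      generalize g.toLinearMap.lTensor Y (Y.coact w) = q
      induction p with
      | zero => simp [pair]
      | add x x' hx hx' =>
        simp only [pair, TensorProduct.add_tmul, map_add, smul_add] at hx hx' ⊢
        rw [hx, hx']
      | tmul v' a' =>
        induction q with
        | zero => simp [pair]
        | add y y' hy hy' =>
          simp only [pair, TensorProduct.tmul_add, map_add, smul_add] at hy hy' ⊢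
          rw [hy, hy']
        | tmul w' b' =>
          simp only [mulTensor_tmul, TensorProduct.comm_tmul, TensorProduct.smul_tmul', pair_tmul,
            smul_eq_mul]
          congr 1
          ring

theorem act_extend {C : Type*} [CommRing C] [Algebra K C] [Differential K]
    [Differential B] [DifferentialAlgebra K B] [Differential C] [DifferentialAlgebra K C]
    (X : DiffRep K A) (φ : B →ₐ[K] C) (g : A →ₐ[K] B) :
    X.act (φ.comp g) = extendScalars φ (X.act g) := by
  refine linearMap_ext_one_tmul fun v => ?_
  rw [extendScalars_tmul, act_tmul, act_tmul, one_smul, one_smul, one_smul]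
  generalize X.coact v = p
  induction p with
  | zero => simp
  | add x y hx hy => simp only [map_add, hx, hy]
  | tmul w a => simp

end Coefficient

/-! ### The action respects the group law and the derivation -/

section Points

variable {K A : Type u} [Field K] [Differential K] [CommRing A] [HopfAlgebra K A]
  [Differential A] [DiffHopfAlgebra K A]
  {B : Type*} [CommRing B] [Algebra K B] [Differential B] [DifferentialAlgebra K B]

/-- The identity of G(B) is a ↦ ε(a)·1, so this is the counit axiom of X. -/
theorem act_one (X : DiffRep K A) :
    X.act (1 : DiffAlgHom K A B).toAlgHom = LinearMap.id := by
  refine linearMap_ext_one_tmul fun v => ?_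
  rw [act_tmul, one_smul, LinearMap.id_apply]
  conv_rhs => rw [← X.counit v]
  generalize X.coact v = p
  induction p with
  | zero => simp
  | add x y hx hy => simp only [map_add, TensorProduct.tmul_add, hx, hy]
  | tmul w a =>
    change algebraMap K B (Coalgebra.counit a) ⊗ₜ[K] w = _
    simp [Algebra.algebraMap_eq_smul_one, TensorProduct.smul_tmul']

/-- Acting by h and then by g evaluates h on the last leg of (ρ ⊗ id)ρ(v) and g on the middle one.
By coassociativity this is (g ⊗ h) ∘ Δ on the A-leg of ρ(v). -/
theorem act_mul (X : DiffRep K A) (g h : DiffAlgHom K A B) :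
    X.act (g * h).toAlgHom = X.act g.toAlgHom ∘ₗ X.act h.toAlgHom := by
  refine linearMap_ext_one_tmul fun v => ?_
  have h1 : ∀ p : X ⊗[K] A, X.act g.toAlgHom (TensorProduct.comm K X B
      (h.toAlgHom.toLinearMap.lTensor X p)) =
      TensorProduct.comm K X B (LinearMap.lTensor X
        ((Algebra.TensorProduct.lmul' K).comp
          (Algebra.TensorProduct.map g.toAlgHom h.toAlgHom)).toLinearMap
        (TensorProduct.assoc K X A A (X.coact.rTensor A p))) := by
    intro p
    induction p with
    | zero => simp
    | add x y hx hy => simp only [map_add, hx, hy]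
    | tmul w a =>
      rw [LinearMap.rTensor_tmul, LinearMap.lTensor_tmul, TensorProduct.comm_tmul, act_tmul]
      generalize X.coact w = q
      induction q with
      | zero => simp
      | add x y hx hy => simp only [map_add, TensorProduct.add_tmul, smul_add, hx, hy]
      | tmul w' a' => simp [TensorProduct.smul_tmul', mul_comm]
  rw [LinearMap.comp_apply, act_tmul, act_tmul, one_smul, one_smul, h1, X.coassoc]
  generalize X.coact v = p
  induction p with
  | zero => simp
  | add x y hx hy => simp only [map_add, hx, hy]
  | tmul w a => rfl

/-- After the Leibniz rule for b, the terms in ∂v match because g commutes with ∂ and the coaction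
on ∂v is ∂(ρ(v)); the terms in b′ match because v ↦ 1 ⊗ v respects the coactions. -/
theorem baseChangeDer_act (X : DiffRep K A) (g : DiffAlgHom K A B) (x : B ⊗[K] X) :
    Prolong.baseChangeDer K B X (X.act g.toAlgHom x) =
      X.prolong.act g.toAlgHom (Prolong.baseChangeDer K B X x) := by
  induction x with
  | zero => simp
  | add x y hx hy => simp only [map_add, hx, hy]
  | tmul b v =>
    rw [Prolong.baseChangeDer_tmul, map_add, act_tmul, act_tmul, act_tmul, baseChangeDer_smul]
    have h1 : X.prolong.coact (Prolong.der v) = coactDer K A X (X.coact v) := prolongCoact_der X v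
    have h2 : X.prolong.coact (Prolong.incl K v) = (Prolong.incl K).rTensor A (X.coact v) :=
      prolongCoact_incl X v
    rw [h1, h2]
    generalize X.coact v = p
    -- Aligns the b-terms and the b′-terms of the two sides.
    rw [add_comm]
    congr 2
    · induction p with
      | zero => simp
      | add x y hx hy => simp only [map_add, hx, hy]
      | tmul w a => simp [coactDer, g.map_deriv]
    · induction p with
      | zero => simp
      | add x y hx hy => simp only [map_add, hx, hy]
      | tmul w a => simp

/-- The action of a point of `G` on `B ⊗ X`, as an automorphism. -/
def actEquiv (X : DiffRep K A) (g : DiffAlgHom K A B) : (B ⊗[K] X) ≃ₗ[B] (B ⊗[K] X) :=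
  LinearEquiv.ofLinearMap (X.act g.toAlgHom) (X.act (g⁻¹).toAlgHom)
    (by rw [← act_mul, mul_inv_cancel, act_one])
    (by rw [← act_mul, inv_mul_cancel, act_one])

theorem isDiffTensorAut_actEquiv (g : DiffAlgHom K A B) :
    IsDiffTensorAut (fun X : DiffRep K A => X.actEquiv g) where
  tensor X Y x y := act_tensor X Y g.toAlgHom x y
  unit x := act_unit g.toAlgHom x
  natural _ _ α x := act_natural g.toAlgHom α x
  deriv X x := baseChangeDer_act X g x

end Points

end DiffRep

/-- The homomorphism `G(B) → Aut^{⊗,∂}(ω)(B)` given by the action on representations. -/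
def pointsToAut (K A : Type u) [Field K] [Differential K] [CommRing A] [HopfAlgebra K A]
    [Differential A] [DiffHopfAlgebra K A] (B : Type*) [CommRing B] [Algebra K B] [Differential B]
    [DifferentialAlgebra K B] : DiffAlgHom K A B →* diffTensorAut K A B where
  toFun g := ⟨fun X => X.actEquiv g, DiffRep.isDiffTensorAut_actEquiv g⟩
  map_one' := Subtype.ext (funext fun X => LinearEquiv.toLinearMap_injective X.act_one)
  map_mul' g h := Subtype.ext (funext fun X => LinearEquiv.toLinearMap_injective (X.act_mul g h))

/-! ### Finite dimensional subcomodules of `A` -/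

section Subcomodule

variable {K A : Type u} [Field K] [CommRing A] [HopfAlgebra K A]

/-- A subspace `V` of `A` is a *(right) subcomodule* if `Δ(V) ⊆ V ⊗ A`. -/
def IsSubcomodule (V : Submodule K A) : Prop :=
  ∀ a ∈ V, Coalgebra.comul (R := K) a ∈ LinearMap.range (V.subtype.rTensor A)

theorem range_rTensor_subtype_mono {V W : Submodule K A} (h : V ≤ W) :
    LinearMap.range (V.subtype.rTensor A) ≤ LinearMap.range (W.subtype.rTensor A) := by
  rintro _ ⟨x, rfl⟩
  refine ⟨(Submodule.inclusion h).rTensor A x, ?_⟩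
  rw [← LinearMap.rTensor_comp_apply, Submodule.subtype_comp_inclusion]

/-- Makes the finite dimensional subcomodules directed: values computed in two of them can be
compared in their sum. -/
theorem IsSubcomodule.sup {V W : Submodule K A} (hV : IsSubcomodule V) (hW : IsSubcomodule W) :
    IsSubcomodule (V ⊔ W) := by
  intro a ha
  obtain ⟨v, hv, w, hw, rfl⟩ := Submodule.mem_sup.1 ha
  rw [map_add]
  exact add_mem (range_rTensor_subtype_mono le_sup_left (hV v hv))
    (range_rTensor_subtype_mono le_sup_right (hW w hw))

/-- The image of a coefficient map is a subcomodule. -/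
theorem isSubcomodule_range_coefficient (X : DiffRep K A) (f : X →ₗ[K] K) :
    IsSubcomodule (LinearMap.range (X.coefficient f)) := by
  rintro _ ⟨v, rfl⟩
  refine ⟨(X.coefficient f).rangeRestrict.rTensor A (X.coact v), ?_⟩
  rw [← LinearMap.rTensor_comp_apply, LinearMap.subtype_comp_codRestrict, X.comul_coefficient]

/-- Coassociativity: with T = (id ⊗ f) ∘ Δ it reads Δ(T a) = (id ⊗ T)(Δ a). The operator T on the
right touches only the second leg, so it preserves V ⊗ A for any subspace V. -/
theorem comul_rid_lTensor (f : A →ₗ[K] K) (a : A) :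
    Coalgebra.comul (R := K) (TensorProduct.rid K A (f.lTensor A (Coalgebra.comul (R := K) a))) =
      ((TensorProduct.rid K A).toLinearMap ∘ₗ f.lTensor A ∘ₗ Coalgebra.comul).lTensor A
        (Coalgebra.comul (R := K) a) := by
  rw [LinearMap.lTensor_comp_apply, LinearMap.lTensor_comp_apply, ← Coalgebra.coassoc_apply]
  generalize Coalgebra.comul (R := K) a = p
  induction p with
  | zero => simp
  | add x y hx hy => simp only [map_add, hx, hy]
  | tmul b c =>
    rw [LinearMap.rTensor_tmul, LinearMap.lTensor_tmul, TensorProduct.rid_tmul, map_smul]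
    generalize Coalgebra.comul (R := K) b = q
    induction q with
    | zero => simp
    | add x y hx hy => simp only [map_add, smul_add, TensorProduct.add_tmul, hx, hy]
    | tmul d e => simp

/-- Every element of `A` lies in a finite dimensional subcomodule. -/
theorem exists_isSubcomodule_mem (a : A) :
    ∃ V : Submodule K A, Module.Finite K V ∧ IsSubcomodule V ∧ a ∈ V := by
  let e := Module.Basis.ofVectorSpace K A
  -- Writes Δ(a) = ∑ bᵢ ⊗ eᵢ as a finite sum; the required subspace is spanned by the bᵢ.
  obtain ⟨b, hb⟩ := TensorProduct.eq_repr_basis_right e (Coalgebra.comul (R := K) a)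
  have hcoord : ∀ i, b i = TensorProduct.rid K A
      ((e.coord i).lTensor A (Coalgebra.comul (R := K) a)) := by
    intro i
    rw [← hb, Finsupp.sum, map_sum, map_sum]
    classical
    simp [Finsupp.single_apply, Finset.sum_ite_eq']
  let V : Submodule K A := Submodule.span K (b '' b.support)
  have hmem : ∀ i ∈ b.support, b i ∈ V := fun i hi => Submodule.subset_span ⟨i, hi, rfl⟩
  have hrange : Coalgebra.comul (R := K) a ∈ LinearMap.range (V.subtype.rTensor A) := by
    rw [← hb]
    exact Submodule.sum_mem _ fun i hi => ⟨⟨b i, hmem i hi⟩ ⊗ₜ e i, by simp⟩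
  refine ⟨V, ?_, ?_, ?_⟩
  · exact Module.Finite.span_of_finite K (b.support.finite_toSet.image b)
  · intro c hc
    induction hc using Submodule.span_induction with
    | mem x hx =>
      obtain ⟨i, -, rfl⟩ := hx
      -- Since bᵢ = (id ⊗ eᵢ*)(Δ a), its coproduct comes from Δ(a), which lies in V ⊗ A, by an
      -- operator on the second leg.
      rw [hcoord, comul_rid_lTensor]
      obtain ⟨p, hp⟩ := hrange
      rw [← hp, ← LinearMap.comp_apply, LinearMap.lTensor_comp_rTensor,
        ← LinearMap.rTensor_comp_lTensor]
      exact ⟨_, rfl⟩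
    | zero => rw [map_zero]; exact zero_mem _
    | add x y _ _ hx hy => rw [map_add]; exact add_mem hx hy
    | smul k x _ hx => rw [map_smul]; exact Submodule.smul_mem _ _ hx
  -- The counit law gives a = ∑ ε(eᵢ) bᵢ.
  · have h := congrArg (TensorProduct.rid K A) (Coalgebra.lTensor_counit_comul (R := K) a)
    rw [TensorProduct.rid_tmul, one_smul, ← hb, Finsupp.sum, map_sum, map_sum] at h
    rw [← h]
    exact Submodule.sum_mem _ fun i hi => by
      simpa using Submodule.smul_mem V _ (hmem i hi)

/-- The coaction of a subcomodule of `A`. -/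
def subcomoduleCoact (V : Submodule K A) (hV : IsSubcomodule V) : V →ₗ[K] V ⊗[K] A :=
  (LinearEquiv.ofInjective (V.subtype.rTensor A)
    (Module.Flat.rTensor_preserves_injective_linearMap _ V.subtype_injective)).symm.toLinearMap ∘ₗ
    LinearMap.codRestrict _ (Coalgebra.comul ∘ₗ V.subtype) fun v => hV v v.2

/-- This determines the coaction: V ⊗ A → A ⊗ A is injective by flatness over a field, so comodule
identities on V can be checked inside A. -/
theorem rTensor_subcomoduleCoact (V : Submodule K A) (hV : IsSubcomodule V) (v : V) :
    V.subtype.rTensor A (subcomoduleCoact V hV v) = Coalgebra.comul (R := K) (v : A) := by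
  have h := LinearEquiv.apply_symm_apply (LinearEquiv.ofInjective (V.subtype.rTensor A)
    (Module.Flat.rTensor_preserves_injective_linearMap _ V.subtype_injective))
    (LinearMap.codRestrict _ (Coalgebra.comul ∘ₗ V.subtype) (fun v => hV v v.2) v)
  exact congrArg Subtype.val h

/-- A finite dimensional subcomodule of `A`, as a representation. -/
abbrev DiffRep.ofSubcomodule (V : Submodule K A) [Module.Finite K V] (hV : IsSubcomodule V) :
    DiffRep K A where
  carrier := V
  coact := subcomoduleCoact V hV
  coassoc v := by
    -- Inside A ⊗ (A ⊗ A) the claim becomes coassociativity of Δ.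
    apply Module.Flat.rTensor_preserves_injective_linearMap (M := A ⊗[K] A) _ V.subtype_injective
    have h1 : ∀ p : V ⊗[K] A, V.subtype.rTensor (A ⊗[K] A)
        (TensorProduct.assoc K V A A ((subcomoduleCoact V hV).rTensor A p)) =
        TensorProduct.assoc K A A A ((Coalgebra.comul (R := K)).rTensor A
          (V.subtype.rTensor A p)) := by
      intro p
      induction p with
      | zero => simp
      | add x y hx hy => simp only [map_add, hx, hy]
      | tmul w a =>
        rw [LinearMap.rTensor_tmul, LinearMap.rTensor_tmul, LinearMap.rTensor_tmul,
          Submodule.subtype_apply, ← rTensor_subcomoduleCoact V hV]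
        generalize subcomoduleCoact V hV w = q
        induction q with
        | zero => simp
        | add x y hx hy => simp only [map_add, TensorProduct.add_tmul, hx, hy]
        | tmul w' a' => simp
    rw [h1, rTensor_subcomoduleCoact, Coalgebra.coassoc_apply, ← rTensor_subcomoduleCoact V hV,
      ← LinearMap.comp_apply, LinearMap.lTensor_comp_rTensor, ← LinearMap.rTensor_comp_lTensor,
      LinearMap.comp_apply]
  counit v := by
    apply V.subtype_injective
    have h := congrArg (TensorProduct.rid K A) (Coalgebra.lTensor_counit_comul (R := K) (v : A))
    rw [TensorProduct.rid_tmul, one_smul, ← rTensor_subcomoduleCoact V hV] at h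
    refine Eq.trans ?_ h
    generalize subcomoduleCoact V hV v = q
    induction q with
    | zero => simp
    | add x y hx hy => simp only [map_add, hx, hy]
    | tmul w a => simp

/-- A linear map into a subcomodule `V` whose composition with `V → A` is compatible with the
coactions is a morphism of representations. -/
def DiffRep.homToSubcomodule (X : DiffRep K A) (V : Submodule K A) [Module.Finite K V]
    (hV : IsSubcomodule V) (α : X →ₗ[K] V)
    (hα : ∀ v, Coalgebra.comul (R := K) (α v : A) = (V.subtype ∘ₗ α).rTensor A (X.coact v)) :
    DiffRep.Hom X (DiffRep.ofSubcomodule V hV) where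
  toLinearMap := α
  comm v := by
    apply Module.Flat.rTensor_preserves_injective_linearMap (M := A) _ V.subtype_injective
    rw [rTensor_subcomoduleCoact, hα, LinearMap.rTensor_comp_apply]

/-- The restriction of the counit to a subspace of `A`. -/
def counitOn (V : Submodule K A) : V →ₗ[K] K := Coalgebra.counit ∘ₗ V.subtype

/-- This is the counit law (ε ⊗ id) ∘ Δ = id. It makes every element of A a matrix coefficient. -/
theorem coefficient_counitOn (V : Submodule K A) [Module.Finite K V] (hV : IsSubcomodule V)
    (v : V) : (DiffRep.ofSubcomodule V hV).coefficient (counitOn V) v = v := by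
  rw [DiffRep.coefficient_apply, counitOn, LinearMap.rTensor_comp_apply,
    rTensor_subcomoduleCoact, Coalgebra.rTensor_counit_comul, TensorProduct.lid_tmul, one_smul]

end Subcomodule

/-! ### Recovering a point from a tensor automorphism -/

section Reconstruction

variable {K A : Type u} [Field K] [Differential K] [CommRing A] [HopfAlgebra K A]
  [Differential A] [DiffHopfAlgebra K A]
  {B : Type*} [CommRing B] [Algebra K B] [Differential B] [DifferentialAlgebra K B]
  {l : ∀ X : DiffRep K A, (B ⊗[K] X) ≃ₗ[B] (B ⊗[K] X)}

theorem IsDiffTensorAut.baseFunctional_eq_of_hom (hl : IsDiffTensorAut l) {X Y : DiffRep K A}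
    (α : DiffRep.Hom X Y) (f : Y →ₗ[K] K) (v : X) :
    baseFunctional B f (l Y (1 ⊗ₜ α.toLinearMap v)) =
      baseFunctional B (f ∘ₗ α.toLinearMap) (l X (1 ⊗ₜ v)) := by
  rw [← baseFunctional_baseChange, ← hl.natural, LinearMap.baseChange_tmul]

/-- The inclusion V → W is a morphism of representations and the counit on W restricts to that on V,
so naturality applies. -/
theorem IsDiffTensorAut.baseFunctional_counitOn_of_le (hl : IsDiffTensorAut l)
    {V W : Submodule K A} [Module.Finite K V] [Module.Finite K W] (hV : IsSubcomodule V)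
    (hW : IsSubcomodule W) (h : V ≤ W) (v : V) :
    baseFunctional B (counitOn W)
        (l (DiffRep.ofSubcomodule W hW) (1 ⊗ₜ Submodule.inclusion h v)) =
      baseFunctional B (counitOn V) (l (DiffRep.ofSubcomodule V hV) (1 ⊗ₜ v)) :=
  hl.baseFunctional_eq_of_hom (DiffRep.homToSubcomodule (DiffRep.ofSubcomodule V hV) W hW
    (Submodule.inclusion h) fun v => (rTensor_subcomoduleCoact V hV v).symm) (counitOn W) v

/-- The value at `a` of the point attached to the family `l`: it is `(id ⊗ ε)(λ_V(1 ⊗ a))`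
for any finite dimensional subcomodule `V` of `A` that contains `a`. -/
def pointValue (l : ∀ X : DiffRep K A, (B ⊗[K] X) ≃ₗ[B] (B ⊗[K] X)) (a : A) : B :=
  have h := (exists_isSubcomodule_mem (K := K) a).choose_spec
  have := h.1
  baseFunctional B (counitOn _) (l (DiffRep.ofSubcomodule _ h.2.1) (1 ⊗ₜ ⟨a, h.2.2⟩))

/-- Both V and the subcomodule chosen in the definition embed in their sum, where the two values
agree. -/
theorem IsDiffTensorAut.pointValue_eq (hl : IsDiffTensorAut l) {V : Submodule K A}
    [Module.Finite K V] (hV : IsSubcomodule V) (v : V) :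
    pointValue l (v : A) =
      baseFunctional B (counitOn V) (l (DiffRep.ofSubcomodule V hV) (1 ⊗ₜ v)) := by
  have h := (exists_isSubcomodule_mem (K := K) (v : A)).choose_spec
  have := h.1
  rw [← hl.baseFunctional_counitOn_of_le hV (h.2.1.sup hV) le_sup_right]
  exact (hl.baseFunctional_counitOn_of_le h.2.1 (h.2.1.sup hV) le_sup_left ⟨v, h.2.2⟩).symm

/-- The matrix coefficients of `λ_X` are the values of the point at those of `X`. -/
theorem IsDiffTensorAut.pointValue_coefficient (hl : IsDiffTensorAut l) (X : DiffRep K A)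
    (f : X →ₗ[K] K) (v : X) :
    pointValue l (X.coefficient f v) = baseFunctional B f (l X (1 ⊗ₜ v)) := by
  have h := hl.baseFunctional_eq_of_hom (DiffRep.homToSubcomodule X _
    (isSubcomodule_range_coefficient X f) (X.coefficient f).rangeRestrict
    fun v => X.comul_coefficient f v) (counitOn _) v
  -- Naturality along c_f : X → range c_f yields the functional ε ∘ c_f, which is f.
  have hf : counitOn (LinearMap.range (X.coefficient f)) ∘ₗ (X.coefficient f).rangeRestrict = f :=
    LinearMap.ext fun v => X.counit_coefficient f v
  exact (hl.pointValue_eq (isSubcomodule_range_coefficient X f)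
    ((X.coefficient f).rangeRestrict v)).trans (h.trans
      (congrArg (fun f' => baseFunctional B f' (l X (1 ⊗ₜ v))) hf))

/-- The element 1 of A is the coefficient of the unit object, on which λ is the identity. -/
theorem IsDiffTensorAut.pointValue_one (hl : IsDiffTensorAut l) : pointValue l 1 = 1 := by
  have h := hl.pointValue_coefficient (DiffRep.unit K A) LinearMap.id (1 : K)
  rw [hl.unit, baseFunctional_tmul] at h
  have hc : (DiffRep.unit K A).coefficient LinearMap.id (1 : K) = 1 := by
    simp [DiffRep.coefficient]
  rw [hc] at h
  simpa using h

theorem IsDiffTensorAut.pointValue_smul (hl : IsDiffTensorAut l) (k : K) (a : A) :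
    pointValue l (k • a) = k • pointValue l a := by
  obtain ⟨V, _, hV, ha⟩ := exists_isSubcomodule_mem (K := K) a
  have h1 := hl.pointValue_eq hV ⟨a, ha⟩
  have h2 := hl.pointValue_eq hV (k • ⟨a, ha⟩)
  -- The scalar of K is moved into B so that B-linearity of λ_V applies.
  rw [TensorProduct.tmul_smul, ← algebraMap_smul B k ((1 : B) ⊗ₜ[K] (⟨a, ha⟩ : V)), map_smul,
    map_smul, ← h1, algebraMap_smul] at h2
  exact h2

theorem IsDiffTensorAut.pointValue_add (hl : IsDiffTensorAut l) (a b : A) :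
    pointValue l (a + b) = pointValue l a + pointValue l b := by
  obtain ⟨V, _, hV, ha⟩ := exists_isSubcomodule_mem (K := K) a
  obtain ⟨W, _, hW, hb⟩ := exists_isSubcomodule_mem (K := K) b
  have h1 := hl.pointValue_eq (hV.sup hW) ⟨a, Submodule.mem_sup_left ha⟩
  have h2 := hl.pointValue_eq (hV.sup hW) ⟨b, Submodule.mem_sup_right hb⟩
  have h3 := hl.pointValue_eq (hV.sup hW)
    (⟨a, Submodule.mem_sup_left ha⟩ + ⟨b, Submodule.mem_sup_right hb⟩)
  rw [TensorProduct.tmul_add, map_add, map_add, ← h1, ← h2] at h3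
  exact h3

theorem IsDiffTensorAut.pointValue_mul (hl : IsDiffTensorAut l) (a b : A) :
    pointValue l (a * b) = pointValue l a * pointValue l b := by
  obtain ⟨V, _, hV, ha⟩ := exists_isSubcomodule_mem (K := K) a
  obtain ⟨W, _, hW, hb⟩ := exists_isSubcomodule_mem (K := K) b
  let X := DiffRep.ofSubcomodule V hV
  let Y := DiffRep.ofSubcomodule W hW
  -- The product ab is the coefficient of a ⊗ b for the functional ε ⊗ ε on V ⊗ W, so the tensor
  -- condition computes its value.
  have hc : ∀ (v : X) (w : Y), (X.tensor Y).coefficient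
      (LinearMap.mul' K K ∘ₗ TensorProduct.map (counitOn V) (counitOn W)) (v ⊗ₜ w) =
      X.coefficient (counitOn V) v * Y.coefficient (counitOn W) w := by
    intro v w
    rw [DiffRep.coefficient_apply, DiffRep.coefficient_apply, DiffRep.coefficient_apply]
    change TensorProduct.lid K A (LinearMap.rTensor A _
      (DiffRep.mulTensor K X Y A (X.coact v ⊗ₜ Y.coact w))) = _
    generalize X.coact v = p
    generalize Y.coact w = q
    induction p with
    | zero => simp
    | add x x' hx hx' => simp only [TensorProduct.add_tmul, map_add, add_mul, hx, hx']
    | tmul v' a' =>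
      induction q with
      | zero => simp
      | add y y' hy hy' => simp only [TensorProduct.tmul_add, map_add, mul_add, hy, hy']
      | tmul w' b' => simp [mul_smul, smul_comm (counitOn V v')]
  have h := hl.pointValue_coefficient (X.tensor Y)
    (LinearMap.mul' K K ∘ₗ TensorProduct.map (counitOn V) (counitOn W))
    ((⟨a, ha⟩ : V) ⊗ₜ (⟨b, hb⟩ : W))
  have ht := hl.tensor X Y (1 ⊗ₜ (⟨a, ha⟩ : V)) (1 ⊗ₜ (⟨b, hb⟩ : W))
  rw [pair_tmul, mul_one] at ht
  rw [hc, coefficient_counitOn, coefficient_counitOn, ht, baseFunctional_pair,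
    ← hl.pointValue_eq, ← hl.pointValue_eq] at h
  exact h

/-! ### Derivatives of matrix coefficients -/

/-- The functional `1 ⊗ v + ∂ ⊗ w ↦ f(v) + ∂(f(w))` on `V⁽¹⁾`. -/
def Prolong.functional {V : Type*} [AddCommGroup V] [Module K V] (f : V →ₗ[K] K) :
    Prolong V →ₗ[K] K where
  toFun x := f x.coeff0 + Differential.deriv (f x.coeff1)
  map_add' x y := by simp only [coeff0_add, coeff1_add, map_add]; abel
  map_smul' k x := by
    -- The term -k′ f(v₁) from the twisted scalar action cancels the Leibniz term of ∂(k f(v₁)).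
    simp only [coeff0_smul, coeff1_smul, map_sub, map_smul, smul_eq_mul, Derivation.leibniz,
      RingHom.id_apply]
    ring

@[simp] theorem Prolong.functional_incl {V : Type*} [AddCommGroup V] [Module K V]
    (f : V →ₗ[K] K) (v : V) : functional f (incl K v) = f v := by
  simp [functional]

@[simp] theorem Prolong.functional_der {V : Type*} [AddCommGroup V] [Module K V]
    (f : V →ₗ[K] K) (v : V) : functional f (der v) = (f v)′ := by
  simp [functional]

theorem Prolong.baseFunctional_functional {V : Type*} [AddCommGroup V] [Module K V]
    (f : V →ₗ[K] K) (x : B ⊗[K] V) :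
    baseFunctional B (functional f) (baseChangeDer K B V x) = (baseFunctional B f x)′ := by
  induction x with
  | zero => simp
  | add x y hx hy => simp only [map_add, hx, hy]
  | tmul b v => simp [deriv_algebraMap, mul_comm]

/-- The prolonged coaction sends ∂v to ∂(ρ(v)), and the functional turns this into ∂ on A by the
Leibniz rule for f(w)·a. So ∂ of a coefficient of X is a coefficient of the prolongation. -/
theorem DiffRep.coefficient_functional (X : DiffRep K A) (f : X →ₗ[K] K) (v : X) :
    X.prolong.coefficient (Prolong.functional f) (Prolong.der v) = (X.coefficient f v)′ := by
  rw [coefficient_apply, coefficient_apply]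
  have h : X.prolong.coact (Prolong.der v) = coactDer K A X (X.coact v) := prolongCoact_der X v
  rw [h]
  generalize X.coact v = p
  induction p with
  | zero => simp
  | add x y hx hy => simp only [map_add, hx, hy]
  | tmul w a =>
    have h := isLeibniz_derivHom K A (f w) a
    simp only [derivHom_apply] at h
    simp [coactDer, h]

theorem IsDiffTensorAut.pointValue_deriv (hl : IsDiffTensorAut l) (a : A) :
    pointValue l a′ = (pointValue l a)′ := by
  obtain ⟨V, _, hV, ha⟩ := exists_isSubcomodule_mem (K := K) a
  let X := DiffRep.ofSubcomodule V hV
  have h := hl.pointValue_coefficient X.prolong (Prolong.functional (counitOn V))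
    (Prolong.der (⟨a, ha⟩ : V))
  have hd := hl.deriv X (1 ⊗ₜ (⟨a, ha⟩ : V))
  -- As 1′ = 0, the derivative of 1 ⊗ a is 1 ⊗ ∂a, so condition (iv) gives λ on ∂a as the derivative
  -- of λ_V(1 ⊗ a).
  rw [Prolong.baseChangeDer_tmul, Derivation.map_one_eq_zero, TensorProduct.zero_tmul,
    add_zero] at hd
  rw [DiffRep.coefficient_functional X, coefficient_counitOn, ← hd,
    Prolong.baseFunctional_functional, ← hl.pointValue_eq] at h
  exact h

/-! ### Bijectivity and naturality in B -/

/-- The point of `G` attached to a differential tensor automorphism. -/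
def IsDiffTensorAut.point (hl : IsDiffTensorAut l) : DiffAlgHom K A B where
  toAlgHom := AlgHom.ofLinearMap
    { toFun := pointValue l
      map_add' := hl.pointValue_add
      map_smul' := hl.pointValue_smul } hl.pointValue_one hl.pointValue_mul
  map_deriv := hl.pointValue_deriv

/-- Both sides have the same matrix entries, by `baseFunctional_act` and
`IsDiffTensorAut.pointValue_coefficient`, and functionals separate. -/
theorem IsDiffTensorAut.act_point (hl : IsDiffTensorAut l) (X : DiffRep K A) :
    X.act hl.point.toAlgHom = (l X).toLinearMap := by
  refine DiffRep.linearMap_ext_one_tmul fun v => eq_of_baseFunctional_eq fun f => ?_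
  rw [DiffRep.baseFunctional_act]
  exact hl.pointValue_coefficient X f v

theorem pointsToAut_bijective : Function.Bijective (pointsToAut K A B) := by
  constructor
  · intro g h hgh
    refine DiffAlgHom.ext (AlgHom.ext fun a => ?_)
    obtain ⟨V, _, hV, ha⟩ := exists_isSubcomodule_mem (K := K) a
    have hX : (DiffRep.ofSubcomodule V hV).act g.toAlgHom =
        (DiffRep.ofSubcomodule V hV).act h.toAlgHom :=
      congrArg (fun m : diffTensorAut K A B => (m.1 (DiffRep.ofSubcomodule V hV)).toLinearMap) hgh
    -- As a is its own coefficient on V, applying the counit to the action on 1 ⊗ a reads off g(a)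
    -- and h(a).
    have h1 := congrArg (fun m => baseFunctional B (counitOn V) (m (1 ⊗ₜ (⟨a, ha⟩ : V)))) hX
    have hg := DiffRep.baseFunctional_act (DiffRep.ofSubcomodule V hV) g.toAlgHom
      (counitOn V) ⟨a, ha⟩
    have hh := DiffRep.baseFunctional_act (DiffRep.ofSubcomodule V hV) h.toAlgHom
      (counitOn V) ⟨a, ha⟩
    rw [coefficient_counitOn] at hg hh
    exact hg.symm.trans (h1.trans hh)
  · rintro ⟨l, hl⟩
    exact ⟨IsDiffTensorAut.point hl, Subtype.ext (funext fun X =>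
      LinearEquiv.toLinearMap_injective (IsDiffTensorAut.act_point hl X))⟩

theorem pointsToAut_pointsMap {C : Type*} [CommRing C] [Algebra K C] [Differential C]
    [DifferentialAlgebra K C] (φ : DiffAlgHom K B C) (g : DiffAlgHom K A B) :
    pointsToAut K A C (DiffAlgHom.pointsMap φ g) = diffTensorAutMap φ (pointsToAut K A B g) :=
  Subtype.ext (funext fun X => LinearEquiv.toLinearMap_injective
    (X.act_extend φ.toAlgHom g.toAlgHom))

end Reconstruction

/-- The isomorphism of group functors `G ≅ Aut^{⊗,∂}(ω)`. -/
def pointsIsoAut (K A : Type u) [Field K] [Differential K] [CommRing A] [HopfAlgebra K A]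
    [Differential A] [DiffHopfAlgebra K A] :
    pointsFunctor K A ⋙ GrpCat.uliftFunctor.{u + 1, u} ≅ diffTensorAutFunctor K A :=
  NatIso.ofComponents
    -- Tensor automorphisms are families over a type of representations one universe up, hence the
    -- lift of G(B).
    (fun B => (MulEquiv.ulift.trans
      (MulEquiv.ofBijective (pointsToAut K A B) pointsToAut_bijective)).toGrpIso)
    (fun {B C} φ => by
      refine GrpCat.hom_ext (MonoidHom.ext ?_)
      rintro ⟨g⟩
      refine Eq.trans ?_ ((pointsToAut_pointsMap (B := B) (C := C) φ g).trans ?_)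
      · rfl
      · rfl)

end DiffTannaka

end

theorem mainTheorem1 (K A : Type u) [Field K] [CharZero K] [Differential K]
    [CommRing A] [HopfAlgebra K A] [Differential A] [DiffTannaka.DiffHopfAlgebra K A]
    (hA : DiffTannaka.FinitelyDiffGenerated K A) :
    ∃ e : DiffTannaka.pointsFunctor K A ⋙ GrpCat.uliftFunctor.{u + 1, u} ≅
        DiffTannaka.diffTensorAutFunctor K A,
      ∀ (B : DiffTannaka.DiffAlg K) (g : DiffTannaka.DiffAlgHom K A B)
        (X : DiffTannaka.DiffRep K A),
        (((e.hom.app B).hom (ULift.up g) : DiffTannaka.diffTensorAut K A B).1 X).toLinearMap =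
          X.act g.toAlgHom :=
  ⟨DiffTannaka.pointsIsoAut K A, fun _ _ _ => rfl⟩
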